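/- For $t_z\ge 0$ and $\epsilon\in\mathbb R$, let the three- and two-dimensional densities of states be $$N_{t_z}(\epsilon)=\int_{[-\pi,\pi]^3}\delta\big(2(\cos k_1+\cos k_2)+2t_z\cos k_3+\epsilon\big)\frac{dk_1dk_2dk_3}{(2\pi)^3},\qquad N_0(\epsilon)=\int_{[-\pi,\pi]^2}\delta\big(2(\cos k_1+\cos k_2)+\epsilon\big)\frac{dk_1dk_2}{(2\pi)^2},$$ where $\int_{[-\pi,\pi]^n}\delta(g(k)+\epsilon)\frac{dk}{(2\pi)^n}$ denotes the derivative with respect to $\epsilon$ of the normalized Lebesgue measure $(2\pi)^{-n}\,\big|\{k\in[-\pi,\pi]^n : g(k)+\epsilon\ge 0\}\big|$ (set to $0$ where this derivative does not exist). **Theorem.** Let $t_z\in(0,2)$ and $r=\min(2t_z,\,4-2t_z)$. The derivative defining $N_0(\epsilon)$ exists for all $\epsilon\in(-4,4)\setminus\{0\}$, and the derivative defining $N_{t_z}(\epsilon)$ exists for $|\epsilon|<r$. The function $N_{t_z}$ is even on $\mathbb R$ and real analytic on $\{|\epsilon|<r\}$, and $$N_{t_z}(\epsilon)=\sum_{j=0}^\infty\frac{N_{t_z}^{(2j)}(0)}{(2j)!}\,\epsilon^{2j}\qquad\text{for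 } |\epsilon|<r.$$ Furthermore, $$N_{t_z}(0)=\int_{-2}^2\frac{N_0(t_zu)}{\sqrt{4-u^2}}\,\frac{du}{\pi},$$ $N_0$ has a unique analytic continuation $\tilde N_0$ from $(0,4)$ to $\{\epsilon\in\mathbb C:\operatorname{Im}\epsilon>0\}$, and $$N_{t_z}^{(2j)}(0)=\operatorname{Re}\left(\int_{\gamma_{-2,2}}\frac{\tilde N_0^{(2j)}(t_zu)}{\sqrt{4-u^2}}\,\frac{du}{\pi}\right)\qquad\text{for } j=1,2,\dots,$$ where $\gamma_{-2,2}$ is the clockwise semicircle of radius $2$ centred at $0$ in the upper half-plane, starting at $-2$ and ending at $2$, and the principal branch of the square root is used. All these integrals converge absolutely. -/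

import Mathlib

open scoped Real

noncomputable section

/-- The box `[-π, π]ⁿ` of momenta. -/
def momentumBox (n : ℕ) : Set (Fin n → ℝ) :=
  Set.Icc (fun _ => -π) (fun _ => π)

/-- `∫_{[-π,π]ⁿ} θ(g(k) + ε) dk / (2π)ⁿ`, where `θ` is the Heaviside step function: the
normalized Lebesgue measure of the set of momenta in the box with `g(k) + ε ≥ 0`. -/
def stepAverage {n : ℕ} (g : (Fin n → ℝ) → ℝ) (ε : ℝ) : ℝ :=
  MeasureTheory.volume.real {k ∈ momentumBox n | 0 ≤ g k + ε} / (2 * π) ^ n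

/-- `∫_{[-π,π]ⁿ} δ(g(k) + ε) dk / (2π)ⁿ`, where `δ = θ'` is the Dirac delta: the derivative with
respect to `ε` of `∫_{[-π,π]ⁿ} θ(g(k) + ε) dk / (2π)ⁿ`. -/
def deltaAverage {n : ℕ} (g : (Fin n → ℝ) → ℝ) (ε : ℝ) : ℝ :=
  deriv (stepAverage g) ε

/-- `2 (cos k₁ + cos k₂)`, minus the two-dimensional band relation. -/
def hopping2D (k : Fin 2 → ℝ) : ℝ :=
  2 * (Real.cos (k 0) + Real.cos (k 1))

/-- `2 (cos k₁ + cos k₂) + 2 t_z cos k₃`, minus the three-dimensional band relation. -/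
def hopping3D (tz : ℝ) (k : Fin 3 → ℝ) : ℝ :=
  2 * (Real.cos (k 0) + Real.cos (k 1)) + 2 * tz * Real.cos (k 2)

/-- The two-dimensional density of states `N₀(ε)`. -/
def dos2D (ε : ℝ) : ℝ :=
  deltaAverage hopping2D ε

/-- The three-dimensional density of states `N_{t_z}(ε)`. -/
def dos3D (tz ε : ℝ) : ℝ :=
  deltaAverage (hopping3D tz) ε

/-- `F` is an analytic continuation of `N₀` from the interval `(0, 4)` to the open upper
half-plane: it is analytic in a neighbourhood of every point of `(0, 4)` and of the open upper
half-plane, and it agrees with `N₀` on `(0, 4)`. Its values elsewhere are irrelevant. -/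
def IsUpperContinuation (F : ℂ → ℂ) : Prop :=
  AnalyticOnNhd ℂ F ({z : ℂ | 0 < z.im} ∪ {z : ℂ | z.im = 0 ∧ 0 < z.re ∧ z.re < 4}) ∧
    ∀ ε : ℝ, 0 < ε → ε < 4 → F (ε : ℂ) = (dos2D ε : ℂ)

/-- The pull-back `γ'(θ) f(γ(θ))` of `f(u) du` under the parametrization `γ(θ) = 2 e^{iθ}`. -/
def semicircleIntegrand (f : ℂ → ℂ) (θ : ℝ) : ℂ :=
  deriv (circleMap 0 2) θ * f (circleMap 0 2 θ)

/-- `∫_γ f(u) du` over the clockwise semicircle `γ` in the upper half-plane from `-2` to `2`,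
that is, `u = 2 e^{iθ}` with `θ` running from `π` down to `0`. -/
def semicircleIntegral (f : ℂ → ℂ) : ℂ :=
  ∫ θ in π..0, semicircleIntegrand f θ

/-- The function `u ↦ F^{(m)}(t_z u) / (π √(4 - u²))` with the principal branch of the square
root, which is analytic in the upper half-plane and positive on `(-2, 2)`. -/
def contourKernel (F : ℂ → ℂ) (tz : ℝ) (m : ℕ) (u : ℂ) : ℂ :=
  iteratedDeriv m F ((tz : ℂ) * u) / (4 - u ^ 2) ^ (1 / 2 : ℂ) / (π : ℂ)

end

/-! ### Step averages by slicing, and particle-hole symmetry -/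

section

open MeasureTheory Set

/-! Slicing off one momentum at a time writes each integrated density of states as an average of
translates of the one below it, starting from an arccosine in dimension one. Hence $N_{t}(e)$ should
equal $\int_{-2}^2 N_0(e+tu)\,(4-u^2)^{-1/2}\,du/\pi$. Since $N_0$ is singular at $0$, inside the
range of $e+tu$, this cannot simply be differentiated under the integral sign.

The remedy is a contour shift. On $(0,4)$, $N_0(e)=K(e/4)/(2\pi^2)$, where $K$ (`complementaryK`) is
an elliptic integral. In the variable $v=e^x$, turning the path of $K$ by a quarter turn splits it
into a ray and an arc (`slitK_eq_rayK_add_arcK`). This form is holomorphic in the disc slit along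
the negative imaginary axis, so it reaches the negative reals from above. There the arc part is
purely imaginary and the ray part takes conjugate values at $\pm a$, so the real part of the
continuation is even: $N_0=\mathrm{Re}$ `dosBranch` on both $(0,4)$ and $(-4,0)$
(`dos2D_eq_dosBranch_re`). At $0$ the branch is $O(|p|^{-1/2})$ from above, which is integrable.

Inside the real part the chord $[-2,2]$ may therefore be replaced by the upper semicircle
(`integral_chord_eq_arcAverage`). If $|e|<2t$ and $|e|+2t<4$, the points $e+tu$ with $u$ on the
semicircle avoid the slit and stay in the disc, so the integral is holomorphic in complex $e$ and
can be differentiated under the sign (`hasDerivAt_arcAverage`). Analyticity, the Taylor series on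
$|e|<r$ and the derivative formulas follow. Evenness is the momentum shift by $\pi$, and uniqueness
of the continuation is the identity theorem. -/

lemma measurableSet_step {n : ℕ} {h : (Fin n → ℝ) → ℝ} (hh : Measurable h) (ε : ℝ) :
    MeasurableSet {k ∈ momentumBox n | 0 ≤ h k + ε} :=
  measurableSet_Icc.inter (measurableSet_le measurable_const (hh.add_const ε))

lemma volume_momentumBox (n : ℕ) : volume (momentumBox n) = ENNReal.ofReal (2 * π) ^ n := by
  rw [momentumBox, Real.volume_Icc_pi]
  simp [two_mul]

/-- Fubini in the last momentum: fixing it merely shifts the energy by `φ x`. -/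
lemma stepAverage_add_last {n : ℕ} {h : (Fin n → ℝ) → ℝ} (hh : Measurable h) {φ : ℝ → ℝ}
    (hφ : Measurable φ) (ε : ℝ) :
    stepAverage (fun k : Fin (n + 1) → ℝ => h (fun i => k i.castSucc) + φ (k (Fin.last n))) ε =
      (∫ x in -π..π, stepAverage h (ε + φ x)) / (2 * π) := by
  have hS := measurableSet_step (n := n + 1)
    (h := fun k : Fin (n + 1) → ℝ => h (fun i => k i.castSucc) + φ (k (Fin.last n)))
    (by fun_prop) ε
  set S := {k ∈ momentumBox (n + 1) |
    0 ≤ h (fun i => k i.castSucc) + φ (k (Fin.last n)) + ε} with hSdef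
  have hmp := (volume_preserving_piFinSuccAbove (fun _ : Fin (n + 1) => ℝ) (Fin.last n)).symm
  have hS' : MeasurableSet ((MeasurableEquiv.piFinSuccAbove (fun _ : Fin (n + 1) => ℝ)
      (Fin.last n)).symm ⁻¹' S) := (MeasurableEquiv.measurable _) hS
  have hslice (x : ℝ) : Prod.mk x ⁻¹' ((MeasurableEquiv.piFinSuccAbove (fun _ : Fin (n + 1) => ℝ)
      (Fin.last n)).symm ⁻¹' S) =
      {k | x ∈ Icc (-π) π ∧ k ∈ momentumBox n ∧ 0 ≤ h k + (ε + φ x)} := by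
    ext k
    simp only [MeasurableEquiv.piFinSuccAbove_symm_apply, mem_preimage, hSdef, momentumBox,
      mem_ofPred_eq, Set.mem_Icc, Pi.le_def, Fin.insertNthEquiv, Equiv.coe_fn_mk,
      Fin.forall_fin_succ', Fin.insertNth_last', Fin.snoc_castSucc, Fin.snoc_last]
    have : h k + φ x + ε = h k + (ε + φ x) := by ring
    rw [this]
    tauto
  have hvol : volume.real S = ∫ x in -π..π, volume.real {k ∈ momentumBox n | 0 ≤ h k + (ε + φ x)} := by
    rw [measureReal_def, ← hmp.measure_preimage hS.nullMeasurableSet, Measure.volume_eq_prod,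
      Measure.prod_apply hS', intervalIntegral.integral_of_le (by linarith [Real.pi_pos]),
      ← setIntegral_congr_set (Ioc_ae_eq_Icc (α := ℝ)).symm]
    have h1 : (∫⁻ x, volume (Prod.mk x ⁻¹' ((MeasurableEquiv.piFinSuccAbove
        (fun _ : Fin (n + 1) => ℝ) (Fin.last n)).symm ⁻¹' S))) =
        ∫⁻ x in Icc (-π) π, volume {k ∈ momentumBox n | 0 ≤ h k + (ε + φ x)} := by
      rw [← lintegral_indicator measurableSet_Icc]
      refine lintegral_congr fun x => ?_
      rw [hslice]
      by_cases hx : x ∈ Icc (-π) π <;> simp [hx, -mem_Icc]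
    rw [h1, ← integral_toReal]
    · rfl
    · have h2 := measurable_measure_prodMk_left (ν := (volume : Measure (Fin n → ℝ)))
        (s := {p : ℝ × (Fin n → ℝ) | p.2 ∈ momentumBox n ∧ 0 ≤ h p.2 + (ε + φ p.1)})
        ((measurable_snd measurableSet_Icc).inter (measurableSet_le measurable_const
          ((hh.comp measurable_snd).add ((hφ.comp measurable_fst).const_add ε))))
      exact h2.aemeasurable
    · refine Filter.Eventually.of_forall fun x => (measure_mono (fun k hk => hk.1)).trans_lt
        (b := volume (momentumBox n)) ?_
      rw [volume_momentumBox]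
      exact ENNReal.pow_lt_top ENNReal.ofReal_lt_top
  simp only [stepAverage]
  rw [intervalIntegral.integral_div, ← hvol, pow_succ, div_div]

lemma stepAverage_cos (ε : ℝ) :
    stepAverage (fun k : Fin 1 → ℝ => 2 * Real.cos (k 0)) ε = Real.arccos (-(ε / 2)) / π := by
  have hpi := Real.pi_pos
  have h0 := stepAverage_add_last (n := 0) (h := fun _ => 0) measurable_const
    (φ := fun x => 2 * Real.cos x) (by fun_prop) ε
  have h1 (x : ℝ) : stepAverage (n := 0) (fun _ => 0) x = if 0 ≤ x then 1 else 0 := by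
    have h2 : momentumBox 0 = univ := by
      ext k; simp [momentumBox]
    split_ifs with h <;> simp [stepAverage, h, h2, measureReal_def, volume_pi]
  simp only [h1, zero_add] at h0
  have h3 : (fun k : Fin 1 → ℝ => 2 * Real.cos (k 0)) =
    fun k => 2 * Real.cos (k (Fin.last 0)) := rfl
  rw [h3, h0]
  have h4 : (∫ x in -π..π, if 0 ≤ ε + 2 * Real.cos x then (1 : ℝ) else 0) =
      2 * Real.arccos (-(ε / 2)) := by
    rw [intervalIntegral.integral_of_le (by linarith), setIntegral_congr_set Ioc_ae_eq_Icc]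
    have h5 : (fun x : ℝ => if 0 ≤ ε + 2 * Real.cos x then (1 : ℝ) else 0) =
        {x : ℝ | 0 ≤ ε + 2 * Real.cos x}.indicator 1 := by
      ext x; simp [indicator_apply]
    have h6 : MeasurableSet {x : ℝ | 0 ≤ ε + 2 * Real.cos x} :=
      measurableSet_le measurable_const (by fun_prop)
    rw [h5, setIntegral_indicator h6]
    simp only [Pi.one_apply, integral_const, smul_eq_mul, mul_one, measureReal_restrict_apply_univ]
    -- Equality holds only almost everywhere: for `ε < -2` the set is empty, whereas `arccos` is
    -- clamped to `0` and leaves the interval `{0}`.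
    have h9 : Icc (-Real.arccos (-(ε / 2))) (Real.arccos (-(ε / 2))) =ᵐ[volume]
        (Icc (-π) π ∩ {x : ℝ | 0 ≤ ε + 2 * Real.cos x} : Set ℝ) := by
      rcases le_or_gt (-(ε / 2)) 1 with h7 | h7
      · suffices hs : Icc (-Real.arccos (-(ε / 2))) (Real.arccos (-(ε / 2))) =
            (Icc (-π) π ∩ {x : ℝ | 0 ≤ ε + 2 * Real.cos x} : Set ℝ) by
          rw [hs]; exact ae_eq_refl _
        ext x
        simp only [mem_Icc, mem_inter_iff, mem_ofPred_eq, ← abs_le]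
        constructor
        · intro hx
          refine ⟨hx.trans (Real.arccos_le_pi _), ?_⟩
          have h8 := Real.cos_le_cos_of_nonneg_of_le_pi (abs_nonneg x) (Real.arccos_le_pi _) hx
          rw [Real.cos_abs] at h8
          rcases le_or_gt (-1) (-(ε / 2)) with h10 | h10
          · rw [Real.cos_arccos h10 h7] at h8
            linarith
          · linarith [Real.neg_one_le_cos x]
        · rintro ⟨hx, h8⟩
          rw [← Real.arccos_cos (abs_nonneg x) hx, Real.cos_abs]
          exact Real.arccos_le_arccos (by linarith)
      · rw [Real.arccos_of_one_le h7.le]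
        have h10 : (Icc (-π) π ∩ {x : ℝ | 0 ≤ ε + 2 * Real.cos x} : Set ℝ) = ∅ := by
          ext x
          simp only [mem_inter_iff, mem_ofPred_eq, mem_empty_iff_false, iff_false, not_and, not_le]
          intro
          linarith [Real.cos_le_one x]
        rw [h10, neg_zero, Icc_self]
        exact ae_eq_set.mpr (by simp)
    rw [← measureReal_congr h9, Real.volume_real_Icc_of_le (by linarith [Real.arccos_nonneg (-(ε / 2))])]
    ring
  rw [h4]
  field_simp

lemma stepAverage_hopping2D (ε : ℝ) : stepAverage hopping2D ε =
    (∫ k in -π..π, Real.arccos (-((ε + 2 * Real.cos k) / 2)) / π) / (2 * π) := by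
  have h := stepAverage_add_last (n := 1) (h := fun k => 2 * Real.cos (k 0)) (by fun_prop)
    (φ := fun x => 2 * Real.cos x) (by fun_prop) ε
  simp only [stepAverage_cos] at h
  rw [← h]
  congr 1
  ext k
  simp [hopping2D, mul_add]

lemma stepAverage_hopping3D (tz ε : ℝ) : stepAverage (hopping3D tz) ε =
    (∫ k in -π..π, stepAverage hopping2D (ε + 2 * tz * Real.cos k)) / (2 * π) := by
  rw [← stepAverage_add_last (n := 2) (h := hopping2D) (by unfold hopping2D; fun_prop)
    (φ := fun x => 2 * tz * Real.cos x) (by fun_prop) ε]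
  rfl

lemma continuous_stepAverage_hopping2D : Continuous (stepAverage hopping2D) := by
  have : stepAverage hopping2D = fun ε =>
    (∫ k in -π..π, Real.arccos (-((ε + 2 * Real.cos k) / 2)) / π) / (2 * π) :=
      funext stepAverage_hopping2D
  rw [this]
  refine Continuous.div_const ?_ _
  refine intervalIntegral.continuous_parametric_intervalIntegral_of_continuous' ?_ _ _
  simp only [Function.uncurry_def]
  exact (Real.continuous_arccos.comp (by fun_prop)).div_const _

/-- Shift by half a period, using `cos (k + π) = -cos k`. -/
lemma integral_comp_neg_cos (f : ℝ → ℝ) :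
    ∫ k in -π..π, f (-Real.cos k) = ∫ k in -π..π, f (Real.cos k) := by
  have h1 : ∫ k in -π..π, f (-Real.cos k) = ∫ k in -π..π, f (Real.cos (k + π)) := by
    simp [Real.cos_add_pi]
  have h2 : Function.Periodic (fun k => f (Real.cos k)) (2 * π) := fun k => by
    simp [Real.cos_add_two_pi]
  rw [h1, intervalIntegral.integral_comp_add_right (fun k => f (Real.cos k))]
  have h3 := h2.intervalIntegral_add_eq (-π + π) (-π)
  rw [show -π + π + 2 * π = π + π by ring, show -π + 2 * π = π by ring] at h3
  exact h3

lemma stepAverage_hopping2D_neg (ε : ℝ) :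
    stepAverage hopping2D (-ε) = 1 - stepAverage hopping2D ε := by
  have hpi := Real.pi_pos
  rw [stepAverage_hopping2D, stepAverage_hopping2D,
    ← integral_comp_neg_cos fun c => Real.arccos (-((-ε + 2 * c) / 2)) / π]
  have h1 (k : ℝ) : Real.arccos (-((-ε + 2 * -Real.cos k) / 2)) / π =
      1 - Real.arccos (-((ε + 2 * Real.cos k) / 2)) / π := by
    rw [show -((-ε + 2 * -Real.cos k) / 2) = -(-((ε + 2 * Real.cos k) / 2)) by ring,
      Real.arccos_neg]
    field_simp
  simp only [h1]
  rw [intervalIntegral.integral_sub (by simp)]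
  · simp only [intervalIntegral.integral_const, smul_eq_mul]
    field_simp
    ring
  · exact ((Real.continuous_arccos.comp (by fun_prop)).div_const _).intervalIntegrable _ _

lemma stepAverage_hopping3D_neg (tz ε : ℝ) :
    stepAverage (hopping3D tz) (-ε) = 1 - stepAverage (hopping3D tz) ε := by
  have hpi := Real.pi_pos
  rw [stepAverage_hopping3D, stepAverage_hopping3D,
    ← integral_comp_neg_cos fun c => stepAverage hopping2D (-ε + 2 * tz * c)]
  have h1 (k : ℝ) : stepAverage hopping2D (-ε + 2 * tz * -Real.cos k) =
      1 - stepAverage hopping2D (ε + 2 * tz * Real.cos k) := by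
    rw [← stepAverage_hopping2D_neg]
    congr 1
    ring
  simp only [h1]
  rw [intervalIntegral.integral_sub (by simp)]
  · simp only [intervalIntegral.integral_const, smul_eq_mul]
    field_simp
    ring
  · exact (continuous_stepAverage_hopping2D.comp (by fun_prop)).intervalIntegrable _ _

/-- No differentiability is needed: where the derivative fails to exist at `x` it also fails at
`-x`, and both sides are the default `0`. -/
lemma deriv_neg_of_neg_eq_one_sub {D : ℝ → ℝ} (h : ∀ x, D (-x) = 1 - D x) (x : ℝ) :
    deriv D (-x) = deriv D x := by
  have h1 : deriv (fun y => D (-y)) x = -deriv D (-x) := deriv_comp_neg D x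
  have h2 : (fun y => D (-y)) = fun y => 1 - D y := funext h
  rw [h2, deriv_const_sub] at h1
  linarith

lemma dos3D_neg (tz ε : ℝ) : dos3D tz (-ε) = dos3D tz ε :=
  deriv_neg_of_neg_eq_one_sub (stepAverage_hopping3D_neg tz) ε

/-- If `f` is a primitive of `f' ≥ 0`, then the average of the translates of `f` is a primitive of the
average of the translates of `f'`. -/
lemma integral_translate_sub {α : Type*} [MeasurableSpace α] {μ : Measure α} [IsFiniteMeasure μ]
    {f f' : ℝ → ℝ} {s : α → ℝ} (hs : Measurable s) (hf' : Measurable f') (h0 : ∀ x, 0 ≤ f' x)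
    {a b : ℝ} (hab : a ≤ b)
    (hint : ∀ k, IntervalIntegrable f' volume (a + s k) (b + s k))
    (heq : ∀ k, ∫ x in (a + s k)..(b + s k), f' x = f (b + s k) - f (a + s k))
    (hfa : Integrable (fun k => f (a + s k)) μ) (hfb : Integrable (fun k => f (b + s k)) μ) :
    ∫ k, f (b + s k) ∂μ - ∫ k, f (a + s k) ∂μ = ∫ x in a..b, ∫ k, f' (x + s k) ∂μ := by
  have h1 (k : α) : ∫ x in Ioc a b, f' (x + s k) = f (b + s k) - f (a + s k) := by
    rw [← heq, ← intervalIntegral.integral_comp_add_right, intervalIntegral.integral_of_le hab]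
  have h2 (k : α) : IntegrableOn (fun x => f' (x + s k)) (Ioc a b) := by
    rw [← intervalIntegrable_iff_integrableOn_Ioc_of_le hab]
    simpa using (hint k).comp_add_right (s k)
  have hm : Measurable (Function.uncurry fun (k : α) (x : ℝ) => f' (x + s k)) := by
    simp only [Function.uncurry_def]
    exact hf'.comp (measurable_snd.add (hs.comp measurable_fst))
  have h3 : Integrable (Function.uncurry fun (k : α) (x : ℝ) => f' (x + s k))
      (μ.prod (volume.restrict (Ioc a b))) := by
    rw [integrable_prod_iff hm.aestronglyMeasurable]
    refine ⟨Filter.Eventually.of_forall h2, ?_⟩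
    simp only [Function.uncurry_apply_pair, Real.norm_of_nonneg (h0 _), h1]
    exact hfb.sub hfa
  rw [← integral_sub hfb hfa, intervalIntegral.integral_of_le hab, ← integral_integral_swap h3]
  exact integral_congr_ae (Filter.Eventually.of_forall fun k => (h1 k).symm)

/-! ### The two-dimensional density as an elliptic integral -/

/-- The arcsine density on `(-2, 2)`, extended by zero. -/
noncomputable def arcsineDensity (x : ℝ) : ℝ := (√(4 - x ^ 2))⁻¹ / π

lemma arcsineDensity_nonneg (x : ℝ) : 0 ≤ arcsineDensity x := by
  unfold arcsineDensity; positivity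

lemma measurable_arcsineDensity : Measurable arcsineDensity := by
  unfold arcsineDensity; fun_prop

lemma hasDerivAt_arccos_neg_half {x : ℝ} (h1 : x ≠ -2) (h2 : x ≠ 2) :
    HasDerivAt (fun x => Real.arccos (-(x / 2)) / π) (arcsineDensity x) x := by
  have h3 := ((Real.hasDerivAt_arccos (x := -(x / 2)) (fun h => h2 (by linarith))
    (fun h => h1 (by linarith))).comp x ((hasDerivAt_id' x).div_const 2).neg).div_const π
  refine HasDerivAt.congr_deriv h3 ?_
  have h4 : √(4 - x ^ 2) = 2 * √(1 - (-(x / 2)) ^ 2) := by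
    rw [show 4 - x ^ 2 = 2 ^ 2 * (1 - (-(x / 2)) ^ 2) by ring, Real.sqrt_mul (by norm_num),
      Real.sqrt_sq (by norm_num)]
  rw [arcsineDensity, h4, mul_inv, one_div]
  ring

lemma monotone_arccos_neg_half : Monotone fun x => Real.arccos (-(x / 2)) / π := by
  intro x y hxy
  have := Real.arccos_le_arccos (show -(y / 2) ≤ -(x / 2) by linarith)
  have := Real.pi_pos
  dsimp only
  gcongr

/-- The density is almost everywhere the derivative of a monotone function, so its endpoint
singularities need no estimate. -/
lemma intervalIntegrable_arcsineDensity (a b : ℝ) :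
    IntervalIntegrable arcsineDensity volume a b := by
  refine (monotone_arccos_neg_half.monotoneOn (uIcc a b)).intervalIntegrable_deriv.congr_ae ?_
  have : ∀ᵐ x : ℝ, x ∉ ({-2, 2} : Set ℝ) :=
    measure_eq_zero_iff_ae_notMem.mp ((Set.toFinite ({-2, 2} : Set ℝ)).measure_zero volume)
  filter_upwards [ae_restrict_of_ae this] with x hx
  simp only [mem_insert_iff, mem_singleton_iff, not_or] at hx
  exact (hasDerivAt_arccos_neg_half hx.1 hx.2).deriv

lemma integral_arcsineDensity (a b : ℝ) : ∫ x in a..b, arcsineDensity x =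
    Real.arccos (-(b / 2)) / π - Real.arccos (-(a / 2)) / π := by
  refine integral_eq_of_hasDerivAt_off_countable (fun x => Real.arccos (-(x / 2)) / π)
    arcsineDensity (s := {-2, 2}) (Set.toFinite _).countable ?_ ?_
    (intervalIntegrable_arcsineDensity a b)
  · exact ((Real.continuous_arccos.comp (by fun_prop)).div_const _).continuousOn
  · rintro x ⟨-, hx⟩
    simp only [mem_insert_iff, mem_singleton_iff, not_or] at hx
    exact hasDerivAt_arccos_neg_half hx.1 hx.2

lemma monotone_stepAverage_hopping2D : Monotone (stepAverage hopping2D) := by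
  intro x y hxy
  have hpi := Real.pi_pos
  rw [stepAverage_hopping2D, stepAverage_hopping2D]
  gcongr
  refine intervalIntegral.integral_mono_on (by linarith) ?_ ?_ fun k _ =>
    monotone_arccos_neg_half (by linarith)
  all_goals exact ((Real.continuous_arccos.comp (by fun_prop)).div_const _).intervalIntegrable _ _

lemma stepAverage_hopping2D_sub {a b : ℝ} (hab : a ≤ b) :
    stepAverage hopping2D b - stepAverage hopping2D a =
      ∫ x in a..b, (∫ k in -π..π, arcsineDensity (x + 2 * Real.cos k)) / (2 * π) := by
  have hpi : -π ≤ π := by linarith [Real.pi_pos]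
  have hi (c : ℝ) : Integrable (fun k => Real.arccos (-((c + 2 * Real.cos k) / 2)) / π)
      (volume.restrict (Ioc (-π) π)) :=
    (Continuous.integrableOn_Ioc ((Real.continuous_arccos.comp (by fun_prop)).div_const _))
  rw [intervalIntegral.integral_div, stepAverage_hopping2D, stepAverage_hopping2D, ← sub_div]
  simp only [intervalIntegral.integral_of_le hpi]
  rw [integral_translate_sub (μ := volume.restrict (Ioc (-π) π)) (f' := arcsineDensity)
    (f := fun x => Real.arccos (-(x / 2)) / π) (s := fun k => 2 * Real.cos k) (by fun_prop)
    measurable_arcsineDensity arcsineDensity_nonneg hab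
    (fun k => intervalIntegrable_arcsineDensity _ _) (fun k => integral_arcsineDensity _ _)
    (hi a) (hi b)]

lemma two_mul_cos_image : (fun k => 2 * Real.cos k) '' Ioo 0 π = Ioo (-2) 2 := by
  have h1 : Real.cos '' Ioo 0 π = Ioo (-1) 1 := by
    ext u
    constructor
    · rintro ⟨k, hk, rfl⟩
      have h2 := Real.cos_lt_cos_of_nonneg_of_le_pi le_rfl hk.2.le hk.1
      have h3 := Real.cos_lt_cos_of_nonneg_of_le_pi hk.1.le le_rfl hk.2
      simp only [Real.cos_zero, Real.cos_pi] at h2 h3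
      exact ⟨h3, h2⟩
    · rintro ⟨h2, h3⟩
      exact ⟨Real.arccos u, ⟨Real.arccos_pos.mpr h3, Real.arccos_lt_pi.mpr h2⟩,
        Real.cos_arccos h2.le h3.le⟩
  rw [show (fun k => 2 * Real.cos k) = (fun x : ℝ => 2 * x) ∘ Real.cos from rfl, image_comp, h1,
    Set.image_mul_left_Ioo (by norm_num : (0 : ℝ) < 2)]
  norm_num

/-- Evenness of the cosine folds `(-π, π)` onto `(0, π)`, where `u = 2 cos k` is injective with
Jacobian `2 sin k = √(4 - u²)`. -/
lemma integral_comp_two_mul_cos (f : ℝ → ℝ) :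
    ∫ k in -π..π, f (2 * Real.cos k) = 2 * ∫ u in Ioo (-2) 2, f u * (√(4 - u ^ 2))⁻¹ := by
  have hpi := Real.pi_pos
  have h1 : ∫ k in -π..π, f (2 * Real.cos k) = 2 * ∫ k in Ioo 0 π, f (2 * Real.cos k) := by
    have h2 := integral_comp_abs (f := (Iio π).indicator fun k => f (2 * Real.cos k))
    have h3 : (fun x : ℝ => (Iio π).indicator (fun k => f (2 * Real.cos k)) |x|) =
        (Ioo (-π) π).indicator fun k => f (2 * Real.cos k) := by
      ext x
      simp only [indicator_apply, mem_Iio, mem_Ioo, ← abs_lt, Real.cos_abs]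
    rw [h3, integral_indicator measurableSet_Ioo, setIntegral_indicator measurableSet_Iio,
      Ioi_inter_Iio] at h2
    rw [intervalIntegral.integral_of_le (by linarith), integral_Ioc_eq_integral_Ioo, h2]
  rw [h1, ← two_mul_cos_image, integral_image_eq_integral_abs_deriv_smul measurableSet_Ioo
    (f' := fun k => 2 * -Real.sin k)
    (fun k _ => ((Real.hasDerivAt_cos k).const_mul 2).hasDerivWithinAt)]
  · congr 1
    refine setIntegral_congr_fun measurableSet_Ioo fun k hk => ?_
    have h4 : 0 < Real.sin k := Real.sin_pos_of_mem_Ioo hk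
    have h5 : √(4 - (2 * Real.cos k) ^ 2) = 2 * Real.sin k := by
      rw [← Real.sqrt_sq (by positivity : 0 ≤ 2 * Real.sin k)]
      congr 1
      nlinarith [Real.sin_sq_add_cos_sq k]
    rw [h5, smul_eq_mul, show 2 * -Real.sin k = -(2 * Real.sin k) by ring, abs_neg,
      abs_of_pos (by positivity)]
    field_simp
  · intro x hx y hy hxy
    exact Real.injOn_cos ⟨hx.1.le, hx.2.le⟩ ⟨hy.1.le, hy.2.le⟩ (by simpa using hxy)

/-- `½ ∫_0^∞ dv / √(v (1 + a v) (a + v))`, with `v = eˣ`: the complete elliptic integral of the first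
kind with complementary modulus `a`. -/
noncomputable def complementaryK (a : ℝ) : ℝ :=
  ∫ x in Ioi 0, (√((a + Real.exp x) * (a + Real.exp (-x))))⁻¹

lemma hasDerivAt_exp_div (x : ℝ) :
    HasDerivAt (fun x => (Real.exp x - 1) / (Real.exp x + 1))
      (2 * Real.exp x / (Real.exp x + 1) ^ 2) x := by
  have h := Real.exp_pos x
  refine HasDerivAt.congr_deriv (((Real.hasDerivAt_exp x).sub_const 1).div
    ((Real.hasDerivAt_exp x).add_const 1) (by positivity)) ?_
  ring

lemma exp_div_image : (fun x => (Real.exp x - 1) / (Real.exp x + 1)) '' univ = Ioo (-1) 1 := by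
  ext t
  simp only [image_univ, mem_range, mem_Ioo]
  constructor
  · rintro ⟨x, rfl⟩
    have h := Real.exp_pos x
    rw [lt_div_iff₀ (by positivity), div_lt_iff₀ (by positivity)]
    constructor <;> linarith
  · rintro ⟨h1, h2⟩
    refine ⟨Real.log ((1 + t) / (1 - t)), ?_⟩
    have h3 : 0 < 1 - t := by linarith
    have h4 : 0 < 1 + t := by linarith
    rw [Real.exp_log (by positivity)]
    field_simp
    ring

/-- A Möbius substitution in `eˣ` brings the quartic under the root, with zeros `±2` and `-e ± 2`,
to the normal form of `complementaryK`. -/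
lemma integral_arcsineDensity_comp_cos {e : ℝ} (h0 : 0 < e) (h4 : e < 4) :
    ∫ k in -π..π, arcsineDensity (e + 2 * Real.cos k) = complementaryK (e / 4) / π := by
  have hpi := Real.pi_pos
  rw [integral_comp_two_mul_cos fun u => arcsineDensity (e + u)]
  set p := 2 - e / 2 with hp
  have hp0 : 0 < p := by rw [hp]; linarith
  -- For `u ≥ 2 - e` the radicand is nonpositive, and the defaults `√ = 0`, `0⁻¹ = 0` make the
  -- density vanish.
  have h1 : ∫ u in Ioo (-2) 2, arcsineDensity (e + u) * (√(4 - u ^ 2))⁻¹ =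
      ∫ u in Ioo (-2) (2 - e), arcsineDensity (e + u) * (√(4 - u ^ 2))⁻¹ := by
    refine setIntegral_eq_of_subset_of_forall_sdiff_eq_zero measurableSet_Ioo
      (Ioo_subset_Ioo_right (by linarith)) ?_
    rintro u ⟨⟨hu1, hu2⟩, hu⟩
    have hu3 : 2 - e ≤ u := by
      by_contra h
      exact hu ⟨hu1, not_le.mp h⟩
    rw [arcsineDensity, Real.sqrt_eq_zero_of_nonpos (by nlinarith)]
    simp
  -- The substitution is `u = -e/2 + p tanh (x/2)`. It sends `u = -2, 2 - e` to `eˣ = 0, ∞`, and the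
  -- outer zeros `-2 - e, 2` to `eˣ = -e/4, -4/e`.
  have h2 : (fun x => -(e / 2) + p * ((Real.exp x - 1) / (Real.exp x + 1))) '' univ =
      Ioo (-2) (2 - e) := by
    rw [show (fun x => -(e / 2) + p * ((Real.exp x - 1) / (Real.exp x + 1))) =
      (fun y => -(e / 2) + y) ∘ (fun y => p * y) ∘
        fun x => (Real.exp x - 1) / (Real.exp x + 1) from rfl, image_comp, image_comp,
      exp_div_image, Set.image_mul_left_Ioo hp0, Set.image_const_add_Ioo, hp]
    congr 1 <;> ring
  -- The integrand is even in `x`; writing it with `|x|` prepares the folding onto `(0, ∞)`.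
  have h3 : ∫ u in Ioo (-2) (2 - e), arcsineDensity (e + u) * (√(4 - u ^ 2))⁻¹ =
      ∫ x, (√((e / 4 + Real.exp |x|) * (e / 4 + Real.exp (-|x|))))⁻¹ / (4 * π) := by
    rw [← h2, integral_image_eq_integral_abs_deriv_smul MeasurableSet.univ
      (f' := fun x => p * (2 * Real.exp x / (Real.exp x + 1) ^ 2))
      (fun x _ => (((hasDerivAt_exp_div x).const_mul p).const_add _).hasDerivWithinAt),
      setIntegral_univ]
    · refine integral_congr_ae (Filter.Eventually.of_forall fun x => ?_)
      have habs : (e / 4 + Real.exp |x|) * (e / 4 + Real.exp (-|x|)) =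
          (e / 4 + Real.exp x) * (e / 4 + Real.exp (-x)) := by
        rcases abs_choice x with h | h <;> rw [h]
        rw [neg_neg, mul_comm]
      have hE := Real.exp_pos x
      simp only [habs]
      simp only [arcsineDensity, smul_eq_mul, Real.exp_neg]
      set E := Real.exp x
      have h5 : (4 - (e + (-(e / 2) + p * ((E - 1) / (E + 1)))) ^ 2) *
          (4 - (-(e / 2) + p * ((E - 1) / (E + 1))) ^ 2) =
          (8 * p * E / (E + 1) ^ 2) ^ 2 * ((e / 4 + E) * (e / 4 + E⁻¹)) := by
        rw [hp]
        field_simp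
        ring
      have h6 : 0 ≤ 4 - (e + (-(e / 2) + p * ((E - 1) / (E + 1)))) ^ 2 := by
        have h7 : 4 - (e + (-(e / 2) + p * ((E - 1) / (E + 1)))) ^ 2 =
            p * (2 / (E + 1)) * (4 * (e + 4 * E) / (4 * (E + 1))) := by
          rw [hp]
          field_simp
          ring
        rw [h7]
        positivity
      have h8 : √(4 - (e + (-(e / 2) + p * ((E - 1) / (E + 1)))) ^ 2) *
          √(4 - (-(e / 2) + p * ((E - 1) / (E + 1))) ^ 2) =
          8 * p * E / (E + 1) ^ 2 * √((e / 4 + E) * (e / 4 + E⁻¹)) := by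
        rw [← Real.sqrt_mul h6, h5, Real.sqrt_mul (by positivity), Real.sqrt_sq (by positivity)]
      have h9 : 0 < √((e / 4 + E) * (e / 4 + E⁻¹)) := Real.sqrt_pos.mpr (by positivity)
      rw [abs_of_pos (by positivity), div_mul_eq_mul_div, ← mul_inv, h8]
      field_simp
      norm_num
    · intro x _ y _ hxy
      have hx := Real.exp_pos x
      have hy := Real.exp_pos y
      have h5 : (Real.exp x - 1) / (Real.exp x + 1) = (Real.exp y - 1) / (Real.exp y + 1) := by
        have := add_left_cancel hxy
        exact mul_left_cancel₀ hp0.ne' this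
      rw [div_eq_div_iff (by positivity) (by positivity)] at h5
      exact Real.exp_injective (by linarith)
  rw [h1, h3, integral_div,
    integral_comp_abs (f := fun x => (√((e / 4 + Real.exp x) * (e / 4 + Real.exp (-x))))⁻¹),
    complementaryK]
  field_simp
  norm_num

/-! ### Holomorphic parameter integrals and the inverse square root -/

open Filter Topology in
/-- Differentiation under the integral sign for a locally dominated family of holomorphic
functions. -/
theorem hasDerivAt_integral_of_locally_dominated {α : Type*} [MeasurableSpace α] {μ : Measure α}
    {f : ℂ → α → ℂ} {z₀ : ℂ} {V : Set ℂ} (hV : V ∈ 𝓝 z₀) {b : α → ℝ}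
    (hm : ∀ z ∈ V, AEStronglyMeasurable (f z) μ)
    (hd : ∀ᵐ a ∂μ, ∀ z ∈ V, DifferentiableAt ℂ (fun z => f z a) z)
    (hb : ∀ᵐ a ∂μ, ∀ z ∈ V, ‖f z a‖ ≤ b a) (hbi : Integrable b μ) :
    HasDerivAt (fun z => ∫ a, f z a ∂μ) (∫ a, deriv (fun z => f z a) z₀ ∂μ) z₀ := by
  obtain ⟨R, hR, hRV⟩ := Metric.mem_nhds_iff.mp hV
  have hz₀ : z₀ ∈ V := mem_of_mem_nhds hV
  have hsub {z : ℂ} (hz : z ∈ Metric.ball z₀ (R / 2)) :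
      Metric.closedBall z (R / 2) ⊆ Metric.ball z₀ R := fun w hw => by
    rw [Metric.mem_ball] at hz ⊢
    rw [Metric.mem_closedBall] at hw
    linarith [dist_triangle w z z₀]
  -- By Cauchy's estimate on discs of radius `R / 2`, the bound on `f` alone dominates the
  -- derivative.
  refine (hasDerivAt_integral_of_dominated_loc_of_deriv_le (bound := fun a => b a / (R / 2))
    (F' := fun z a => deriv (fun z => f z a) z)
    (Metric.ball_mem_nhds z₀ (half_pos hR)) ?_ ?_ ?_ ?_ (hbi.div_const _) ?_).2
  · filter_upwards [hV] with z hz using hm z hz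
  · exact hbi.mono' (hm z₀ hz₀) (hb.mono fun a ha => ha z₀ hz₀)
  -- Measurability of the derivative: it is the limit of difference quotients along this sequence of
  -- increments.
  · set h : ℕ → ℂ := fun n => ((R / 2 / (n + 1) : ℝ) : ℂ) with hh
    have hpos (n : ℕ) : 0 < R / 2 / (n + 1 : ℝ) := by positivity
    have h1 (n : ℕ) : z₀ + h n ∈ V := by
      refine hRV ?_
      rw [Metric.mem_ball, dist_self_add_left, hh, Complex.norm_real,
        Real.norm_of_nonneg (hpos n).le]
      calc R / 2 / (n + 1 : ℝ) ≤ R / 2 := div_le_self (by positivity) (by linarith [n.cast_nonneg (α := ℝ)])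
        _ < R := by linarith
    have h2 : Tendsto h atTop (𝓝[≠] 0) := by
      refine tendsto_nhdsWithin_iff.mpr ⟨?_, Eventually.of_forall fun n => ?_⟩
      · have := (tendsto_one_div_add_atTop_nhds_zero_nat (𝕜 := ℝ)).const_mul (R / 2)
        rw [mul_zero] at this
        have h3 := (Complex.continuous_ofReal.tendsto _).comp this
        rw [Complex.ofReal_zero] at h3
        refine h3.congr fun n => ?_
        simp only [hh, Function.comp_apply, mul_one_div]
      · exact Complex.ofReal_ne_zero.mpr (hpos n).ne'
    refine aestronglyMeasurable_of_tendsto_ae atTop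
      (f := fun n a => (h n)⁻¹ • (f (z₀ + h n) a - f z₀ a))
      (fun n => ((hm _ (h1 n)).sub (hm _ hz₀)).const_smul (h n)⁻¹) ?_
    filter_upwards [hd] with a ha
    exact (hasDerivAt_iff_tendsto_slope_zero.mp (ha z₀ hz₀).hasDerivAt).comp h2
  · filter_upwards [hd, hb] with a ha hba z hz
    refine Complex.norm_deriv_le_of_forall_mem_sphere_norm_le (half_pos hR) ?_
      fun w hw => hba w (hRV (hsub hz (Metric.sphere_subset_closedBall hw)))
    refine DifferentiableOn.diffContOnCl fun w hw => (ha w (hRV (hsub hz ?_))).differentiableWithinAt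
    exact Metric.closure_ball_subset_closedBall hw
  · filter_upwards [hd] with a ha z hz
    exact (ha z (hRV (hsub hz (Metric.mem_closedBall_self (half_pos hR).le)))).hasDerivAt

/-- The principal branch of `w ↦ 1 / √w`. -/
noncomputable def invSqrt (w : ℂ) : ℂ := w ^ (-(1 / 2) : ℂ)

lemma norm_invSqrt (w : ℂ) : ‖invSqrt w‖ = (√‖w‖)⁻¹ := by
  have h : (-(1 / 2) : ℂ) = ((-(1 / 2) : ℝ) : ℂ) := by push_cast; rfl
  rw [invSqrt, h, Complex.norm_cpow_real, Real.rpow_neg (norm_nonneg _), Real.sqrt_eq_rpow]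

lemma norm_invSqrt_le {w : ℂ} {c : ℝ} (hc : 0 < c) (h : c ≤ ‖w‖) : ‖invSqrt w‖ ≤ (√c)⁻¹ := by
  rw [norm_invSqrt]
  have := Real.sqrt_pos.mpr hc
  gcongr

lemma measurable_invSqrt : Measurable invSqrt := by
  unfold invSqrt; fun_prop

lemma differentiableAt_invSqrt {w : ℂ} (hw : w ∈ Complex.slitPlane) :
    DifferentiableAt ℂ invSqrt w := by
  have h : HasDerivAt invSqrt _ w := (hasDerivAt_id w).cpow_const hw
  exact h.differentiableAt

lemma DifferentiableAt.invSqrt {f : ℂ → ℂ} {z : ℂ} (hf : DifferentiableAt ℂ f z)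
    (h : f z ∈ Complex.slitPlane) : DifferentiableAt ℂ (fun z => _root_.invSqrt (f z)) z :=
  (differentiableAt_invSqrt h).comp z hf

lemma invSqrt_ofReal {x : ℝ} (hx : 0 ≤ x) : invSqrt x = ((√x)⁻¹ : ℝ) := by
  have h : (-(1 / 2) : ℂ) = ((-(1 / 2) : ℝ) : ℂ) := by push_cast; rfl
  rw [invSqrt, h, ← Complex.ofReal_cpow hx, Real.rpow_neg hx, Real.sqrt_eq_rpow]

lemma invSqrt_conj {w : ℂ} (hw : w ∈ Complex.slitPlane) :
    invSqrt (starRingEnd ℂ w) = starRingEnd ℂ (invSqrt w) := by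
  have h : (-(1 / 2) : ℂ) = ((-(1 / 2) : ℝ) : ℂ) := by push_cast; rfl
  rw [invSqrt, Complex.conj_cpow _ _ (Complex.mem_slitPlane_iff_arg.mp hw).1, invSqrt, h,
    Complex.conj_ofReal]

lemma mem_slitPlane_of_re_pos {w : ℂ} (h : 0 < w.re) : w ∈ Complex.slitPlane := Or.inl h

/-- The quarter turns of the two factors of a product of inverse square roots cancel. -/
lemma invSqrt_neg_I_mul_mul_invSqrt_I_mul {u w : ℂ} (hu : 0 < u.re) (hw : 0 < w.re) :
    invSqrt (-Complex.I * u) * invSqrt (Complex.I * w) = invSqrt u * invSqrt w := by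
  have hu0 : u ≠ 0 := fun h => by simp [h] at hu
  have hw0 : w ≠ 0 := fun h => by simp [h] at hw
  have hau := abs_lt.mp (Complex.abs_arg_lt_pi_div_two_iff.mpr (Or.inl hu))
  have haw := abs_lt.mp (Complex.abs_arg_lt_pi_div_two_iff.mpr (Or.inl hw))
  have hI : (-Complex.I) ≠ 0 := neg_ne_zero.mpr Complex.I_ne_zero
  rw [invSqrt, invSqrt, invSqrt, invSqrt, Complex.cpow_def_of_ne_zero (mul_ne_zero hI hu0),
    Complex.cpow_def_of_ne_zero (mul_ne_zero Complex.I_ne_zero hw0),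
    Complex.cpow_def_of_ne_zero hu0, Complex.cpow_def_of_ne_zero hw0,
    Complex.log_mul hI hu0, Complex.log_mul Complex.I_ne_zero hw0, Complex.log_I,
    Complex.log_neg_I, ← Complex.exp_add, ← Complex.exp_add]
  · congr 1
    ring
  · rw [Complex.arg_I]
    constructor <;> linarith
  · rw [Complex.arg_neg_I]
    constructor <;> linarith

lemma add_ofReal_mem_slitPlane {z : ℂ} (hz : z ∈ Complex.slitPlane) {s : ℝ} (hs : 0 ≤ s) :
    z + s ∈ Complex.slitPlane := by
  rcases hz with h | h
  · exact Or.inl (by simpa using by linarith)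
  · exact Or.inr (by simpa using h)

open Topology in
/-- Points near a point of the slit plane stay away from the slit. -/
lemma exists_pos_le_norm_add {z₀ : ℂ} (hz₀ : z₀ ∈ Complex.slitPlane) :
    ∃ c > (0 : ℝ), ∀ᶠ z : ℂ in 𝓝 z₀, ∀ s : ℝ, 0 ≤ s → c ≤ ‖z + s‖ := by
  obtain ⟨δ, hδ, h⟩ := Metric.isOpen_iff.mp Complex.isOpen_slitPlane z₀ hz₀
  refine ⟨δ / 2, half_pos hδ, ?_⟩
  filter_upwards [Metric.ball_mem_nhds z₀ (half_pos hδ)] with z hz s hs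
  by_contra hlt
  rw [not_le] at hlt
  refine Complex.zero_notMem_slitPlane ?_
  -- If `z + s` were this small, `-s` would lie in the slit plane, and so would `0 = -s + s`.
  have h1 : (-s : ℂ) ∈ Metric.ball z₀ δ := by
    rw [Metric.mem_ball] at hz ⊢
    have h2 : dist (-s : ℂ) z = ‖z + s‖ := by
      rw [dist_comm, dist_eq_norm, sub_neg_eq_add]
    linarith [dist_triangle (-s : ℂ) z z₀]
  simpa using add_ofReal_mem_slitPlane (h h1) hs

lemma integrableOn_exp_neg_half : IntegrableOn (fun x => Real.exp (-(1 / 2) * x)) (Ioi 0) :=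
  exp_neg_integrableOn_Ioi 0 (by norm_num)

lemma inv_sqrt_mul_exp {c : ℝ} (hc : 0 ≤ c) (x : ℝ) :
    (√(c * Real.exp x))⁻¹ = (√c)⁻¹ * Real.exp (-(1 / 2) * x) := by
  rw [Real.sqrt_mul hc, mul_inv, ← Real.exp_half, ← Real.exp_neg]
  ring_nf

/-! ### Continuing the elliptic integral and rotating its contour -/

/-- The continuation of `complementaryK` to the slit plane. -/
noncomputable def slitK (z : ℂ) : ℂ :=
  ∫ x in Ioi (0 : ℝ), invSqrt (z + (Real.exp x : ℝ)) * invSqrt (z + (Real.exp (-x) : ℝ))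

/-- The part of the rotated contour for `slitK` along a ray. -/
noncomputable def rayK (z : ℂ) : ℂ :=
  ∫ x in Ioi (0 : ℝ), invSqrt ((Real.exp x : ℝ) + Complex.I * z) *
    invSqrt (-Complex.I * z + (Real.exp (-x) : ℝ))

/-- The part of the rotated contour for `slitK` along a quarter of the unit circle. -/
noncomputable def arcK (z : ℂ) : ℂ :=
  -Complex.I * ∫ t in (0 : ℝ)..(π / 2), invSqrt (1 + z * Complex.exp (Complex.I * t)) *
    invSqrt (1 + z * Complex.exp (-(Complex.I * t)))

lemma complementaryK_eq_slitK {a : ℝ} (ha : 0 < a) : (complementaryK a : ℂ) = slitK a := by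
  rw [complementaryK, slitK, ← integral_complex_ofReal]
  congr 1
  ext x
  have h1 := Real.exp_pos x
  have h2 := Real.exp_pos (-x)
  rw [← Complex.ofReal_add, ← Complex.ofReal_add, invSqrt_ofReal (by positivity),
    invSqrt_ofReal (by positivity), Real.sqrt_mul (by positivity), mul_inv, Complex.ofReal_mul]

open Topology in
-- The growth in `s` gives the factor with `s = eˣ` the decay `e^{-x/2}` that makes `slitK` converge
-- locally uniformly.
lemma exists_pos_mul_le_norm_add {z₀ : ℂ} (hz₀ : z₀ ∈ Complex.slitPlane) :
    ∃ c > (0 : ℝ), ∀ᶠ z : ℂ in 𝓝 z₀, ∀ s : ℝ, 0 ≤ s → c ≤ ‖z + s‖ ∧ c * s ≤ ‖z + s‖ := by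
  obtain ⟨c, hc, h⟩ := exists_pos_le_norm_add hz₀
  set M := ‖z₀‖ + 1 with hM
  have hM0 : 0 < M := by positivity
  have h2 : ∀ᶠ z : ℂ in 𝓝 z₀, ‖z‖ < M :=
    continuous_norm.continuousAt.eventually_lt continuousAt_const (by simp [hM])
  -- `c / (2 * M)` serves `s ≤ 2 * M`; beyond that `‖z‖ < M < s / 2`, so the triangle inequality
  -- gives `s / 2`.
  refine ⟨min c (min (1 / 2) (c / (2 * M))), by positivity, ?_⟩
  filter_upwards [h, h2] with z hz hzM s hs
  refine ⟨(min_le_left _ _).trans (hz s hs), ?_⟩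
  rcases le_or_gt s (2 * M) with hsM | hsM
  · calc min c (min (1 / 2) (c / (2 * M))) * s ≤ c / (2 * M) * (2 * M) := by
          gcongr
          exact (min_le_right _ _).trans (min_le_right _ _)
      _ = c := by field_simp
      _ ≤ _ := hz s hs
  · calc min c (min (1 / 2) (c / (2 * M))) * s ≤ 1 / 2 * s := by
          gcongr
          exact (min_le_right _ _).trans (min_le_left _ _)
      _ ≤ s - ‖z‖ := by linarith
      _ ≤ _ := by
          have := norm_sub_le (z + s) z
          rw [add_sub_cancel_left, Complex.norm_real, Real.norm_of_nonneg hs] at this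
          linarith

lemma differentiableOn_slitK : DifferentiableOn ℂ slitK Complex.slitPlane := by
  intro z₀ hz₀
  obtain ⟨c, hc, h⟩ := exists_pos_mul_le_norm_add hz₀
  have hs : ∀ᶠ z in nhds z₀, z ∈ Complex.slitPlane := Complex.isOpen_slitPlane.mem_nhds hz₀
  refine (hasDerivAt_integral_of_locally_dominated (μ := volume.restrict (Ioi 0)) (h.and hs)
    (b := fun x => (√c)⁻¹ * Real.exp (-(1 / 2) * x) * (√c)⁻¹) ?_ ?_ ?_
    ((integrableOn_exp_neg_half.const_mul _).mul_const _)).differentiableAt.differentiableWithinAt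
  · intro z _
    have := measurable_invSqrt
    exact Measurable.aestronglyMeasurable (by fun_prop)
  · refine Filter.Eventually.of_forall fun x z hz => ?_
    exact DifferentiableAt.fun_mul (DifferentiableAt.invSqrt (f := fun z => z + (Real.exp x : ℝ))
      (by fun_prop) (add_ofReal_mem_slitPlane hz.2 (Real.exp_pos _).le))
      (DifferentiableAt.invSqrt (f := fun z => z + (Real.exp (-x) : ℝ)) (by fun_prop)
        (add_ofReal_mem_slitPlane hz.2 (Real.exp_pos _).le))
  · refine Filter.Eventually.of_forall fun x z hz => ?_
    rw [norm_mul, ← inv_sqrt_mul_exp hc.le]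
    exact mul_le_mul (norm_invSqrt_le (by positivity) (hz.1 _ (Real.exp_pos _).le).2)
      (norm_invSqrt_le hc (hz.1 _ (Real.exp_pos _).le).1) (norm_nonneg _) (by positivity)

/-- The open disc of radius `R`, slit along the negative imaginary axis. -/
def slitDisc (R : ℝ) : Set ℂ := {z | ‖z‖ < R ∧ -Complex.I * z ∈ Complex.slitPlane}

lemma isOpen_slitDisc (R : ℝ) : IsOpen (slitDisc R) :=
  (isOpen_lt continuous_norm continuous_const).inter
    (Complex.isOpen_slitPlane.preimage (by fun_prop))

lemma le_norm_exp_add {z : ℂ} {x ρ : ℝ} (hx : 0 ≤ x) (hz : ‖z‖ ≤ ρ) :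
    (1 - ρ) * Real.exp x ≤ ‖((Real.exp x : ℝ) : ℂ) + Complex.I * z‖ := by
  have h1 := norm_sub_le_norm_add ((Real.exp x : ℝ) : ℂ) (Complex.I * z)
  rw [norm_mul, Complex.norm_I, one_mul, Complex.norm_real,
    Real.norm_of_nonneg (Real.exp_pos x).le] at h1
  have h2 := Real.one_le_exp hx
  nlinarith [norm_nonneg z]

lemma exp_add_I_mul_mem_slitPlane {z : ℂ} {x : ℝ} (hx : 0 ≤ x) (hz : ‖z‖ < 1) :
    ((Real.exp x : ℝ) : ℂ) + Complex.I * z ∈ Complex.slitPlane := by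
  refine mem_slitPlane_of_re_pos ?_
  have h1 := Real.one_le_exp hx
  have h2 := (abs_le.mp (Complex.abs_im_le_norm z)).2
  simp only [Complex.add_re, Complex.ofReal_re, Complex.mul_re, Complex.I_re, zero_mul,
    Complex.I_im, one_mul, zero_sub]
  linarith

lemma aestronglyMeasurable_rayK (z : ℂ) {μ : Measure ℝ} :
    AEStronglyMeasurable (fun x : ℝ => invSqrt ((Real.exp x : ℝ) + Complex.I * z) *
      invSqrt (-Complex.I * z + (Real.exp (-x) : ℝ))) μ := by
  have := measurable_invSqrt
  exact Measurable.aestronglyMeasurable (by fun_prop)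

lemma differentiableOn_rayK : DifferentiableOn ℂ rayK (slitDisc 1) := by
  intro z₀ hz₀
  obtain ⟨c, hc, h⟩ := exists_pos_le_norm_add hz₀.2
  obtain ⟨ρ, hρ1, hρ2⟩ := exists_between hz₀.1
  have h' : ∀ᶠ z in nhds z₀, ∀ s : ℝ, 0 ≤ s → c ≤ ‖-Complex.I * z + s‖ :=
    (continuous_const.mul continuous_id).continuousAt.eventually h
  have h2 : ∀ᶠ z : ℂ in nhds z₀, ‖z‖ < ρ :=
    continuous_norm.continuousAt.eventually_lt continuousAt_const hρ1
  have hs : ∀ᶠ z in nhds z₀, z ∈ slitDisc 1 := (isOpen_slitDisc 1).mem_nhds hz₀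
  refine (hasDerivAt_integral_of_locally_dominated (μ := volume.restrict (Ioi 0))
    ((h'.and h2).and hs)
    (b := fun x => (√(1 - ρ))⁻¹ * Real.exp (-(1 / 2) * x) * (√c)⁻¹) ?_ ?_ ?_
    ((integrableOn_exp_neg_half.const_mul _).mul_const _)).differentiableAt.differentiableWithinAt
  · exact fun z _ => aestronglyMeasurable_rayK z
  · refine (ae_restrict_mem measurableSet_Ioi).mono fun x hx z hz => ?_
    exact DifferentiableAt.fun_mul
      (DifferentiableAt.invSqrt (f := fun z => (Real.exp x : ℝ) + Complex.I * z) (by fun_prop)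
      (exp_add_I_mul_mem_slitPlane (le_of_lt hx) hz.2.1))
      (DifferentiableAt.invSqrt (f := fun z => -Complex.I * z + (Real.exp (-x) : ℝ)) (by fun_prop)
        (add_ofReal_mem_slitPlane hz.2.2 (Real.exp_pos _).le))
  · refine (ae_restrict_mem measurableSet_Ioi).mono fun x hx z hz => ?_
    rw [norm_mul, ← inv_sqrt_mul_exp (by linarith)]
    refine mul_le_mul (norm_invSqrt_le (mul_pos (by linarith) (Real.exp_pos _))
      (le_norm_exp_add (le_of_lt hx) hz.1.2.le))
      (norm_invSqrt_le hc (hz.1.1 _ (Real.exp_pos _).le)) (norm_nonneg _) (by positivity)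

lemma re_one_add_mul_pos {z w : ℂ} (hz : ‖z‖ < 1) (hw : ‖w‖ = 1) : 0 < (1 + z * w).re := by
  have h1 := (abs_le.mp (Complex.abs_re_le_norm (z * w))).1
  rw [norm_mul, hw, mul_one] at h1
  simp only [Complex.add_re, Complex.one_re]
  linarith

lemma one_sub_norm_le {z w : ℂ} (hw : ‖w‖ = 1) : 1 - ‖z‖ ≤ ‖1 + z * w‖ := by
  have h1 := norm_sub_le_norm_add 1 (z * w)
  rwa [norm_mul, hw, mul_one, norm_one] at h1

lemma norm_exp_I_mul (t : ℝ) : ‖Complex.exp (Complex.I * t)‖ = 1 := by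
  rw [mul_comm, Complex.norm_exp_ofReal_mul_I]

lemma norm_exp_neg_I_mul (t : ℝ) : ‖Complex.exp (-(Complex.I * t))‖ = 1 := by
  rw [Complex.exp_neg, norm_inv, norm_exp_I_mul, inv_one]

lemma norm_arcK_integrand_le {z : ℂ} {ρ : ℝ} (hz : ‖z‖ ≤ ρ) (hρ : ρ < 1) (t : ℝ) :
    ‖invSqrt (1 + z * Complex.exp (Complex.I * t)) *
      invSqrt (1 + z * Complex.exp (-(Complex.I * t)))‖ ≤ (1 - ρ)⁻¹ := by
  have h : 0 < 1 - ρ := by linarith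
  rw [norm_mul, ← Real.mul_self_sqrt h.le, mul_inv]
  exact mul_le_mul (norm_invSqrt_le h ((by linarith : 1 - ρ ≤ 1 - ‖z‖).trans
      (one_sub_norm_le (norm_exp_I_mul t))))
    (norm_invSqrt_le h ((by linarith : 1 - ρ ≤ 1 - ‖z‖).trans
      (one_sub_norm_le (norm_exp_neg_I_mul t)))) (norm_nonneg _) (by positivity)

lemma differentiableOn_arcK : DifferentiableOn ℂ arcK (Metric.ball 0 1) := by
  intro z₀ hz₀
  rw [mem_ball_zero_iff] at hz₀
  obtain ⟨ρ, hρ1, hρ2⟩ := exists_between hz₀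
  have h2 : ∀ᶠ z : ℂ in nhds z₀, ‖z‖ < ρ :=
    continuous_norm.continuousAt.eventually_lt continuousAt_const hρ1
  have hpi : 0 ≤ π / 2 := by positivity
  have := (hasDerivAt_integral_of_locally_dominated (μ := volume.restrict (Ioc 0 (π / 2))) h2
    (f := fun z (t : ℝ) => invSqrt (1 + z * Complex.exp (Complex.I * t)) *
      invSqrt (1 + z * Complex.exp (-(Complex.I * t))))
    (b := fun x => (1 - ρ)⁻¹) ?_ ?_ ?_ (integrable_const _)).differentiableAt
  · refine DifferentiableAt.differentiableWithinAt ?_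
    unfold arcK
    simp only [intervalIntegral.integral_of_le hpi]
    exact this.const_mul _
  · intro z _
    have := measurable_invSqrt
    exact Measurable.aestronglyMeasurable (by fun_prop)
  · refine Filter.Eventually.of_forall fun t z hz => ?_
    exact DifferentiableAt.fun_mul
      (DifferentiableAt.invSqrt (f := fun z => 1 + z * Complex.exp (Complex.I * t))
      (by fun_prop) (mem_slitPlane_of_re_pos
      (re_one_add_mul_pos (lt_trans hz hρ2) (norm_exp_I_mul t))))
      (DifferentiableAt.invSqrt (f := fun z => 1 + z * Complex.exp (-(Complex.I * t)))
      (by fun_prop) (mem_slitPlane_of_re_pos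
        (re_one_add_mul_pos (lt_trans hz hρ2) (norm_exp_neg_I_mul t))))
  · exact Filter.Eventually.of_forall fun t z hz => norm_arcK_integrand_le (le_of_lt hz) hρ2 t

lemma norm_arcK_le {z : ℂ} {ρ : ℝ} (hz : ‖z‖ ≤ ρ) (hρ : ρ < 1) :
    ‖arcK z‖ ≤ (1 - ρ)⁻¹ * (π / 2) := by
  rw [arcK, norm_mul, norm_neg, Complex.norm_I, one_mul]
  refine (intervalIntegral.norm_integral_le_of_norm_le_const
    fun t _ => norm_arcK_integrand_le hz hρ t).trans_eq ?_
  rw [sub_zero, abs_of_pos (by positivity)]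

/-- In the closed upper half-plane `-I * z` has nonnegative real part, so adding `e^{-x}` only
increases its modulus. The power `-1/2` is cruder than the true logarithm, but integrable. -/
lemma norm_rayK_le {z : ℂ} {ρ : ℝ} (hz : ‖z‖ ≤ ρ) (hρ : ρ < 1) (h0 : z ≠ 0) (him : 0 ≤ z.im) :
    ‖rayK z‖ ≤ 2 * (√(1 - ρ))⁻¹ * (√‖z‖)⁻¹ := by
  have hz0 := norm_pos_iff.mpr h0
  have h1 : ∫ x in Ioi (0 : ℝ), (√(1 - ρ))⁻¹ * Real.exp (-(1 / 2) * x) * (√‖z‖)⁻¹ =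
      2 * (√(1 - ρ))⁻¹ * (√‖z‖)⁻¹ := by
    rw [integral_mul_const, integral_const_mul, integral_exp_mul_Ioi (by norm_num)]
    rw [mul_zero, Real.exp_zero]
    ring
  rw [← h1]
  refine norm_integral_le_of_norm_le
    ((integrableOn_exp_neg_half.const_mul _).mul_const _) ?_
  refine (ae_restrict_mem measurableSet_Ioi).mono fun x hx => ?_
  rw [norm_mul, ← inv_sqrt_mul_exp (by linarith)]
  refine mul_le_mul (norm_invSqrt_le (mul_pos (by linarith) (Real.exp_pos _))
      (le_norm_exp_add (le_of_lt hx) hz))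
      (norm_invSqrt_le hz0 ?_) (norm_nonneg _) (by positivity)
  have hE := Real.exp_pos (-x)
  rw [Complex.norm_eq_sqrt_sq_add_sq, Complex.norm_eq_sqrt_sq_add_sq]
  apply Real.sqrt_le_sqrt
  simp only [Complex.add_re, Complex.mul_re, Complex.neg_re, Complex.I_re, Complex.neg_im,
    Complex.I_im, Complex.ofReal_re, Complex.add_im, Complex.mul_im, Complex.ofReal_im]
  nlinarith [mul_nonneg him hE.le]

lemma invSqrt_mul_invSqrt_conj {w : ℂ} (hw : w ∈ Complex.slitPlane) :
    invSqrt w * invSqrt (starRingEnd ℂ w) = ((‖w‖⁻¹ : ℝ) : ℂ) := by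
  rw [invSqrt_conj hw, Complex.mul_conj, Complex.normSq_eq_norm_sq, norm_invSqrt, inv_pow,
    Real.sq_sqrt (norm_nonneg _)]

lemma conj_one_add_mul_exp (a t : ℝ) : starRingEnd ℂ (1 + a * Complex.exp (Complex.I * t)) =
    1 + a * Complex.exp (-(Complex.I * t)) := by
  simp [← Complex.exp_conj]

lemma conj_add_exp (a t : ℝ) : starRingEnd ℂ (a + Complex.exp (Complex.I * t)) =
    a + Complex.exp (-(Complex.I * t)) := by
  simp [← Complex.exp_conj]

/-- For real `a` the two factors are conjugate, so the integrand is real and the prefactor `-I`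
makes `arcK` purely imaginary. -/
lemma arcK_ofReal {a : ℝ} (ha : |a| < 1) : arcK a =
    -Complex.I * ((∫ t in (0 : ℝ)..(π / 2), ‖1 + a * Complex.exp (Complex.I * t)‖⁻¹ : ℝ) : ℂ) := by
  rw [arcK, ← intervalIntegral.integral_ofReal]
  congr 1
  refine intervalIntegral.integral_congr fun t _ => ?_
  rw [← conj_one_add_mul_exp, invSqrt_mul_invSqrt_conj]
  exact mem_slitPlane_of_re_pos (re_one_add_mul_pos
    (by rwa [Complex.norm_real, Real.norm_eq_abs]) (norm_exp_I_mul t))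

lemma arcK_ofReal_re {a : ℝ} (ha : |a| < 1) : (arcK a).re = 0 := by
  rw [arcK_ofReal ha]
  simp

lemma neg_I_mul_ofReal_mem_slitPlane {a : ℝ} (ha : a ≠ 0) :
    -Complex.I * a ∈ Complex.slitPlane := Or.inr (by simpa using ha)

lemma ofReal_mem_slitDisc {a R : ℝ} (h0 : a ≠ 0) (h1 : |a| < R) : (a : ℂ) ∈ slitDisc R :=
  ⟨by rwa [Complex.norm_real, Real.norm_eq_abs], neg_I_mul_ofReal_mem_slitPlane h0⟩

lemma rayK_neg_ofReal {a : ℝ} (h0 : a ≠ 0) (h1 : |a| < 1) :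
    rayK ((-a : ℝ) : ℂ) = starRingEnd ℂ (rayK a) := by
  rw [rayK, rayK, ← integral_conj]
  refine setIntegral_congr_fun measurableSet_Ioi fun x hx => ?_
  have h2 : ‖(a : ℂ)‖ < 1 := by rwa [Complex.norm_real, Real.norm_eq_abs]
  simp only [map_mul]
  rw [← invSqrt_conj (exp_add_I_mul_mem_slitPlane (le_of_lt hx) h2),
    ← invSqrt_conj (add_ofReal_mem_slitPlane (neg_I_mul_ofReal_mem_slitPlane h0)
      (Real.exp_pos _).le)]
  simp only [map_add, map_mul, map_neg, Complex.conj_ofReal, Complex.conj_I, Complex.ofReal_neg]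
  ring_nf

lemma integrableOn_rayK {z : ℂ} (hz : z ∈ slitDisc 1) :
    IntegrableOn (fun x : ℝ => invSqrt ((Real.exp x : ℝ) + Complex.I * z) *
      invSqrt (-Complex.I * z + (Real.exp (-x) : ℝ))) (Ioi 0) := by
  obtain ⟨c, hc, h⟩ := exists_pos_le_norm_add hz.2
  have h1 : 0 < 1 - ‖z‖ := by linarith [hz.1]
  refine Integrable.mono' ((integrableOn_exp_neg_half.const_mul (√(1 - ‖z‖))⁻¹).mul_const (√c)⁻¹)
    (aestronglyMeasurable_rayK z) ?_
  refine (ae_restrict_mem measurableSet_Ioi).mono fun x hx => ?_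
  rw [norm_mul, ← inv_sqrt_mul_exp h1.le]
  exact mul_le_mul (norm_invSqrt_le (mul_pos h1 (Real.exp_pos _))
      (le_norm_exp_add (le_of_lt hx) le_rfl))
      (norm_invSqrt_le hc (h.self_of_nhds _ (Real.exp_pos _).le)) (norm_nonneg _) (by positivity)

lemma integrableOn_slitK {z : ℂ} (hz : z ∈ Complex.slitPlane) :
    IntegrableOn (fun x : ℝ => invSqrt (z + (Real.exp x : ℝ)) * invSqrt (z + (Real.exp (-x) : ℝ)))
      (Ioi 0) := by
  obtain ⟨c, hc, h⟩ := exists_pos_mul_le_norm_add hz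
  have := measurable_invSqrt
  refine Integrable.mono' ((integrableOn_exp_neg_half.const_mul (√c)⁻¹).mul_const (√c)⁻¹)
    (Measurable.aestronglyMeasurable (by fun_prop)) ?_
  refine Filter.Eventually.of_forall fun x => ?_
  rw [norm_mul, ← inv_sqrt_mul_exp hc.le]
  exact mul_le_mul (norm_invSqrt_le (by positivity) (h.self_of_nhds _ (Real.exp_pos _).le).2)
    (norm_invSqrt_le hc (h.self_of_nhds _ (Real.exp_pos _).le).1) (norm_nonneg _) (by positivity)

lemma exp_re_nonneg {w : ℂ} (h1 : -(π / 2) ≤ w.im) (h2 : w.im ≤ π / 2) :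
    0 ≤ (Complex.exp w).re := by
  rw [Complex.exp_re]
  exact mul_nonneg (Real.exp_pos _).le (Real.cos_nonneg_of_neg_pi_div_two_le_of_le h1 h2)

lemma norm_le_norm_ofReal_add {a : ℝ} {w : ℂ} (ha : 0 ≤ a) (hw : 0 ≤ w.re) : ‖w‖ ≤ ‖a + w‖ := by
  rw [Complex.norm_eq_sqrt_sq_add_sq, Complex.norm_eq_sqrt_sq_add_sq]
  apply Real.sqrt_le_sqrt
  simp only [Complex.add_re, Complex.ofReal_re, Complex.add_im, Complex.ofReal_im, zero_add]
  nlinarith [mul_nonneg ha hw]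

lemma le_norm_ofReal_add {a : ℝ} {w : ℂ} (hw : 0 ≤ w.re) : a ≤ ‖a + w‖ := by
  refine le_trans ?_ (Complex.re_le_norm _)
  simpa using hw

/-- Rotation of the contour of `slitK` by a quarter turn. -/
lemma slitK_eq_rayK_add_arcK {a : ℝ} (h0 : 0 < a) (h1 : a < 1) :
    slitK a = rayK a + arcK a := by
  have hpi := Real.pi_pos
  set f : ℂ → ℂ := fun ζ => invSqrt (a + Complex.exp ζ) * invSqrt (a + Complex.exp (-ζ)) with hf
  have hre {ζ : ℂ} (h2 : -(π / 2) ≤ ζ.im) (h3 : ζ.im ≤ 0) :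
      0 ≤ (Complex.exp ζ).re ∧ 0 ≤ (Complex.exp (-ζ)).re :=
    ⟨exp_re_nonneg h2 (by linarith), exp_re_nonneg (by rw [Complex.neg_im]; linarith)
      (by rw [Complex.neg_im]; linarith)⟩
  have hpos {w : ℂ} (hw : 0 ≤ w.re) : 0 < (a + w).re := by
    simp only [Complex.add_re, Complex.ofReal_re]
    linarith
  -- Cauchy's theorem on `[0, X] × [-π/2, 0]`, where `exp (±ζ)` have nonnegative real part and both
  -- radicands lie in the right half-plane.
  have hrect (X : ℝ) : (∫ x in (0 : ℝ)..X, f x) - (∫ x in (0 : ℝ)..X, f (x - (π / 2 : ℝ) * Complex.I)) +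
      Complex.I * (∫ y in (0 : ℝ)..(-(π / 2)), f (X + y * Complex.I)) -
      Complex.I * (∫ y in (0 : ℝ)..(-(π / 2)), f (y * Complex.I)) = 0 := by
    have := Complex.integral_boundary_rect_eq_zero_of_differentiableOn f 0
      ((X : ℂ) - (π / 2 : ℝ) * Complex.I) ?_
    · simp only [Complex.zero_re, Complex.zero_im, Complex.sub_re, Complex.sub_im,
        Complex.ofReal_re, Complex.ofReal_im, Complex.mul_re, Complex.mul_im, Complex.I_re,
        Complex.I_im, mul_zero, mul_one, sub_zero, zero_sub, add_zero, zero_add,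
        Complex.ofReal_zero, zero_mul, Complex.ofReal_neg, neg_mul, smul_eq_mul,
        ← sub_eq_add_neg] at this
      exact this
    · intro ζ hζ
      have him := hζ.2
      simp only [Set.mem_preimage, Complex.zero_im, Complex.sub_im, Complex.ofReal_im,
        Complex.mul_im, Complex.ofReal_re, Complex.I_im, Complex.I_re, mul_one, mul_zero, add_zero,
        zero_sub] at him
      rw [uIcc_of_ge (by linarith)] at him
      have h4 := hre him.1 him.2
      exact (DifferentiableAt.fun_mul
        (DifferentiableAt.invSqrt (f := fun ζ => a + Complex.exp ζ) (by fun_prop)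
          (mem_slitPlane_of_re_pos (hpos h4.1)))
        (DifferentiableAt.invSqrt (f := fun ζ => a + Complex.exp (-ζ)) (by fun_prop)
          (mem_slitPlane_of_re_pos (hpos h4.2)))).differentiableWithinAt
  have e1 (x : ℝ) : f x = invSqrt (a + (Real.exp x : ℝ)) * invSqrt (a + (Real.exp (-x) : ℝ)) := by
    simp [hf]
  -- On the lower side the radicands are `-I` and `I` times those of `rayK`; the two quarter turns
  -- cancel.
  have e2 (x : ℝ) : f (x - (π / 2 : ℝ) * Complex.I) =
      invSqrt ((Real.exp x : ℝ) + Complex.I * a) *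
      invSqrt (-Complex.I * a + (Real.exp (-x) : ℝ)) := by
    have hc : Complex.exp ((π / 2 : ℝ) * Complex.I) = Complex.I := by
      rw [Complex.ofReal_div, Complex.ofReal_ofNat, Complex.exp_pi_div_two_mul_I]
    rw [← invSqrt_neg_I_mul_mul_invSqrt_I_mul]
    · have h5 : (a : ℂ) + Complex.exp (x - (π / 2 : ℝ) * Complex.I) =
          -Complex.I * ((Real.exp x : ℝ) + Complex.I * a) := by
        rw [Complex.exp_sub, hc, Complex.div_I, Complex.ofReal_exp]
        linear_combination (a : ℂ) * Complex.I_mul_I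
      have h6 : (a : ℂ) + Complex.exp (-(x - (π / 2 : ℝ) * Complex.I)) =
          Complex.I * (-Complex.I * a + (Real.exp (-x) : ℝ)) := by
        rw [neg_sub, sub_eq_add_neg, Complex.exp_add, hc, Complex.ofReal_exp, Complex.ofReal_neg]
        linear_combination (a : ℂ) * Complex.I_mul_I
      rw [hf]
      simp only
      rw [h5, h6]
    · simpa [-Complex.ofReal_exp] using Real.exp_pos x
    · simpa [-Complex.ofReal_exp] using Real.exp_pos (-x)
  -- Both integrands are inverse moduli, and `|a + e^{it}| = |1 + a e^{it}|` for real `a`. The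
  -- second form has radicands in the right half-plane for every complex parameter in the unit disc.
  have e3 : ∫ y in (0 : ℝ)..(-(π / 2)), f (y * Complex.I) = -∫ t in (0 : ℝ)..(π / 2),
      invSqrt (1 + a * Complex.exp (Complex.I * t)) *
        invSqrt (1 + a * Complex.exp (-(Complex.I * t))) := by
    have h7 := intervalIntegral.integral_comp_neg (a := 0) (b := π / 2)
      (fun y : ℝ => f (y * Complex.I))
    rw [neg_zero] at h7
    rw [← neg_eq_iff_eq_neg, ← intervalIntegral.integral_symm, ← h7]
    refine intervalIntegral.integral_congr fun t ht => ?_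
    rw [uIcc_of_le (by positivity)] at ht
    simp only [hf]
    have h8 : (a : ℂ) + Complex.exp (-(((-t : ℝ) : ℂ) * Complex.I)) =
        a + Complex.exp (Complex.I * t) := by
      push_cast
      ring_nf
    have h9 : (a : ℂ) + Complex.exp (((-t : ℝ) : ℂ) * Complex.I) =
        starRingEnd ℂ (a + Complex.exp (Complex.I * t)) := by
      rw [conj_add_exp]
      push_cast
      ring_nf
    have h10 : 0 < (a + Complex.exp (Complex.I * t)).re := hpos (exp_re_nonneg
      (by simp; linarith [ht.1]) (by simp; linarith [ht.2]))
    have h11 : 0 < (1 + a * Complex.exp (Complex.I * t)).re := re_one_add_mul_pos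
      (by rwa [Complex.norm_real, Real.norm_of_nonneg h0.le]) (norm_exp_I_mul t)
    rw [h8, h9, mul_comm, invSqrt_mul_invSqrt_conj (mem_slitPlane_of_re_pos h10),
      ← conj_one_add_mul_exp, invSqrt_mul_invSqrt_conj (mem_slitPlane_of_re_pos h11)]
    congr 2
    have h12 : (a : ℂ) + Complex.exp (Complex.I * t) =
        Complex.exp (Complex.I * t) * starRingEnd ℂ (1 + a * Complex.exp (Complex.I * t)) := by
      rw [conj_one_add_mul_exp, mul_add, mul_one, mul_left_comm, ← Complex.exp_add, add_neg_cancel,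
        Complex.exp_zero]
      ring
    rw [h12, norm_mul, norm_exp_I_mul, one_mul, RCLike.norm_conj]
  have l1 : Filter.Tendsto (fun X : ℝ => ∫ x in (0 : ℝ)..X, f x) Filter.atTop (nhds (slitK a)) := by
    simp only [e1]
    exact intervalIntegral_tendsto_integral_Ioi 0
      (integrableOn_slitK (mem_slitPlane_of_re_pos (by simpa using h0))) Filter.tendsto_id
  have l2 : Filter.Tendsto (fun X : ℝ => ∫ x in (0 : ℝ)..X, f (x - (π / 2 : ℝ) * Complex.I))
      Filter.atTop (nhds (rayK a)) := by
    simp only [e2]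
    exact intervalIntegral_tendsto_integral_Ioi 0
      (integrableOn_rayK (ofReal_mem_slitDisc h0.ne' (by rwa [abs_of_pos h0]))) Filter.tendsto_id
  -- The right side of the rectangle contributes `O(e^{-X/2})`.
  have l3 : Filter.Tendsto (fun X : ℝ => ∫ y in (0 : ℝ)..(-(π / 2)), f (X + y * Complex.I))
      Filter.atTop (nhds 0) := by
    have h13 : Filter.Tendsto (fun X : ℝ => (√(Real.exp X))⁻¹ * (√a)⁻¹ * |-(π / 2) - 0|)
        Filter.atTop (nhds (0 * (√a)⁻¹ * |-(π / 2) - 0|)) :=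
      ((tendsto_inv_atTop_zero.comp (Real.tendsto_sqrt_atTop.comp
        Real.tendsto_exp_atTop)).mul_const _).mul_const _
    rw [zero_mul, zero_mul] at h13
    refine squeeze_zero_norm (fun X => ?_) h13
    refine intervalIntegral.norm_integral_le_of_norm_le_const fun y hy => ?_
    rw [uIoc_of_ge (by linarith)] at hy
    have h14 := hre (ζ := X + y * Complex.I) (by simpa using hy.1.le) (by simpa using hy.2)
    rw [hf, norm_mul]
    refine mul_le_mul (norm_invSqrt_le (Real.exp_pos X) ?_)
      (norm_invSqrt_le h0 (le_norm_ofReal_add h14.2)) (norm_nonneg _) (by positivity)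
    refine le_trans (le_of_eq ?_) (norm_le_norm_ofReal_add h0.le h14.1)
    rw [Complex.norm_exp]
    simp
  have l4 := ((l1.sub l2).add (l3.const_mul Complex.I)).sub_const
    (Complex.I * (∫ y in (0 : ℝ)..(-(π / 2)), f (y * Complex.I)))
  simp only [hrect] at l4
  have h15 := tendsto_nhds_unique l4 tendsto_const_nhds
  rw [e3] at h15
  rw [arcK]
  linear_combination h15

/-- The real part of the continuation is even: crossing above the branch point changes only the
imaginary part. -/
lemma rayK_add_arcK_re {a : ℝ} (h0 : a ≠ 0) (h1 : |a| < 1) :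
    (rayK a + arcK a).re = complementaryK |a| := by
  have hpos := abs_pos.mpr h0
  have h2 : (rayK (|a| : ℝ)).re = complementaryK |a| := by
    have h3 := congrArg Complex.re (slitK_eq_rayK_add_arcK hpos h1)
    rw [← complementaryK_eq_slitK hpos, Complex.add_re, arcK_ofReal_re (by rwa [abs_abs]),
      add_zero, Complex.ofReal_re] at h3
    exact h3.symm
  rw [Complex.add_re, arcK_ofReal_re h1, add_zero, ← h2]
  rcases abs_choice a with h | h
  · rw [h]
  · rw [h, rayK_neg_ofReal h0 h1, Complex.conj_re]

/-! ### The holomorphic branch of the two-dimensional density -/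

lemma hasDerivAt_of_sub_eq_integral {D g : ℝ → ℝ} {l u e : ℝ} (hg : ContinuousOn g (Ioo l u))
    (h : ∀ a b, l < a → a ≤ b → b < u → D b - D a = ∫ x in a..b, g x) (he : e ∈ Ioo l u) :
    HasDerivAt D (g e) e := by
  obtain ⟨a, ha1, ha2⟩ := exists_between he.1
  have h1 : IntervalIntegrable g volume a e := by
    refine ContinuousOn.intervalIntegrable (hg.mono ?_)
    rw [uIcc_of_le ha2.le]
    exact fun x hx => ⟨ha1.trans_le hx.1, hx.2.trans_lt he.2⟩
  have h2 := (intervalIntegral.integral_hasDerivAt_right h1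
    (hg.stronglyMeasurableAtFilter isOpen_Ioo e he)
    (hg.continuousAt (isOpen_Ioo.mem_nhds he))).add_const (D a)
  refine h2.congr_of_eventuallyEq ?_
  filter_upwards [Ioo_mem_nhds ha2 he.2] with b hb
  rw [← h a b ha1 hb.1.le hb.2]
  ring

/-- The analytic continuation of the two-dimensional density of states from `(0, 4)` to the disc of
radius `4` slit along the negative imaginary axis. -/
noncomputable def dosBranch (p : ℂ) : ℂ := (rayK (p / 4) + arcK (p / 4)) / (2 * π ^ 2 : ℝ)

lemma norm_div_four (p : ℂ) : ‖p / 4‖ = ‖p‖ / 4 := by simp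

lemma div_four_mem_slitDisc {p : ℂ} (hp : p ∈ slitDisc 4) : p / 4 ∈ slitDisc 1 := by
  refine ⟨by rw [norm_div_four]; linarith [hp.1], ?_⟩
  have h2 := hp.2
  rw [Complex.mem_slitPlane_iff] at h2 ⊢
  have h1 : -Complex.I * (p / 4) = ((4⁻¹ : ℝ) : ℂ) * (-Complex.I * p) := by
    push_cast
    ring
  rw [h1, Complex.re_ofReal_mul, Complex.im_ofReal_mul]
  refine h2.imp (fun h => by positivity) (fun h => by positivity)

lemma differentiableOn_dosBranch : DifferentiableOn ℂ dosBranch (slitDisc 4) := by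
  have h1 : DifferentiableOn ℂ (fun p : ℂ => p / 4) (slitDisc 4) := by fun_prop
  refine ((differentiableOn_rayK.comp h1 fun p hp => div_four_mem_slitDisc hp).add
    (differentiableOn_arcK.comp h1 fun p hp => ?_)).div_const _
  rw [mem_ball_zero_iff]
  exact (div_four_mem_slitDisc hp).1

lemma norm_dosBranch_le {ρ : ℝ} (hρ : ρ < 4) : ∃ C, 0 ≤ C ∧ ∀ p : ℂ, p ≠ 0 → 0 ≤ p.im → ‖p‖ ≤ ρ →
    ‖dosBranch p‖ ≤ C * (√‖p‖)⁻¹ := by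
  refine ⟨((2 * (√(1 - ρ / 4))⁻¹) * 2 + |(1 - ρ / 4)⁻¹ * (π / 2)| * 2) / (2 * π ^ 2),
    by positivity, fun p h0 him hp => ?_⟩
  have hn : 0 < ‖p‖ := norm_pos_iff.mpr h0
  have hs : √‖p / 4‖ = √‖p‖ / 2 := by
    rw [norm_div_four, Real.sqrt_div hn.le, show (4 : ℝ) = 2 ^ 2 by norm_num,
      Real.sqrt_sq (by norm_num)]
  have h1 := norm_rayK_le (z := p / 4) (ρ := ρ / 4) (by rw [norm_div_four]; linarith)
    (by linarith) (by simpa using h0) (by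
      rw [show p / 4 = ((4⁻¹ : ℝ) : ℂ) * p by push_cast; ring, Complex.im_ofReal_mul]
      positivity)
  have h2 := norm_arcK_le (z := p / 4) (ρ := ρ / 4) (by rw [norm_div_four]; linarith)
    (by linarith)
  rw [hs, inv_div] at h1
  -- Since `‖p‖ < 4`, the bounded arc term can be absorbed into the singular bound.
  have h3 : 1 ≤ 2 * (√‖p‖)⁻¹ := by
    rw [← div_eq_mul_inv, one_le_div (Real.sqrt_pos.mpr hn)]
    rw [Real.sqrt_le_left (by norm_num)]
    linarith
  rw [dosBranch, norm_div, Complex.norm_real, Real.norm_of_nonneg (by positivity), div_mul_eq_mul_div]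
  gcongr
  calc ‖rayK (p / 4) + arcK (p / 4)‖ ≤ ‖rayK (p / 4)‖ + ‖arcK (p / 4)‖ := norm_add_le _ _
    _ ≤ 2 * (√(1 - ρ / 4))⁻¹ * (2 / √‖p‖) + |(1 - ρ / 4)⁻¹ * (π / 2)| * (2 * (√‖p‖)⁻¹) := by
        gcongr
        exact (h2.trans (le_abs_self _)).trans (le_mul_of_one_le_right (abs_nonneg _) h3)
    _ = _ := by ring

lemma dosBranch_ofReal_re {x : ℝ} (h0 : x ≠ 0) (h4 : |x| < 4) :
    (dosBranch x).re = complementaryK (|x| / 4) / (2 * π ^ 2) := by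
  have h1 : (x : ℂ) / 4 = ((x / 4 : ℝ) : ℂ) := by push_cast; rfl
  have h2 : |x / 4| = |x| / 4 := by rw [abs_div, abs_of_pos (by norm_num : (0 : ℝ) < 4)]
  rw [dosBranch, Complex.div_ofReal_re, h1, rayK_add_arcK_re (by positivity) (by rw [h2]; linarith),
    h2]

lemma continuousOn_complementaryK : ContinuousOn complementaryK (Ioi 0) := by
  have h : ContinuousOn (fun a : ℝ => (slitK a).re) (Ioi 0) :=
    Complex.continuous_re.comp_continuousOn (differentiableOn_slitK.continuousOn.comp
      Complex.continuous_ofReal.continuousOn fun a ha =>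
        mem_slitPlane_of_re_pos (by simpa using ha))
  refine h.congr fun a ha => ?_
  change _ = (slitK a).re
  rw [← complementaryK_eq_slitK ha, Complex.ofReal_re]

lemma hasDerivAt_stepAverage_hopping2D_of_pos {e : ℝ} (h0 : 0 < e) (h4 : e < 4) :
    HasDerivAt (stepAverage hopping2D) (complementaryK (e / 4) / (2 * π ^ 2)) e := by
  refine hasDerivAt_of_sub_eq_integral (l := 0) (u := 4)
    (g := fun e => complementaryK (e / 4) / (2 * π ^ 2)) ?_ ?_ ⟨h0, h4⟩
  · refine (continuousOn_complementaryK.comp (by fun_prop) fun x hx => ?_).div_const _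
    have := hx.1
    simp only [mem_Ioi]
    positivity
  · intro a b ha hab hb
    rw [stepAverage_hopping2D_sub hab]
    refine intervalIntegral.integral_congr fun x hx => ?_
    rw [uIcc_of_le hab] at hx
    rw [integral_arcsineDensity_comp_cos (by linarith [hx.1]) (by linarith [hx.2])]
    rw [div_div]
    ring_nf

/-- Negative energies follow from `D (-x) = 1 - D x`. -/
lemma hasDerivAt_stepAverage_hopping2D {e : ℝ} (h0 : e ≠ 0) (h4 : |e| < 4) :
    HasDerivAt (stepAverage hopping2D) (complementaryK (|e| / 4) / (2 * π ^ 2)) e := by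
  rcases h0.lt_or_gt with h | h
  · have h1 : stepAverage hopping2D = fun x => 1 - stepAverage hopping2D (-x) :=
      funext fun x => by rw [stepAverage_hopping2D_neg]; ring
    rw [abs_of_neg h] at h4 ⊢
    have h2 := hasDerivAt_stepAverage_hopping2D_of_pos (e := -e) (by linarith) h4
    have h3 := (h2.comp e (hasDerivAt_neg e)).const_sub 1
    rw [h1]
    exact h3.congr_deriv (by ring)
  · rw [abs_of_pos h] at h4 ⊢
    exact hasDerivAt_stepAverage_hopping2D_of_pos h h4

lemma dos2D_eq_complementaryK {e : ℝ} (h0 : e ≠ 0) (h4 : |e| < 4) :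
    dos2D e = complementaryK (|e| / 4) / (2 * π ^ 2) :=
  (hasDerivAt_stepAverage_hopping2D h0 h4).deriv

lemma dos2D_eq_dosBranch_re {e : ℝ} (h0 : e ≠ 0) (h4 : |e| < 4) :
    dos2D e = (dosBranch e).re := by
  rw [dos2D_eq_complementaryK h0 h4, dosBranch_ofReal_re h0 h4]

lemma ofReal_div_four (x : ℝ) : (x : ℂ) / 4 = ((x / 4 : ℝ) : ℂ) := by push_cast; rfl

lemma ofReal_dos2D {e : ℝ} (h0 : 0 < e) (h4 : e < 4) :
    (dos2D e : ℂ) = slitK (e / 4) / (2 * π ^ 2 : ℝ) := by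
  rw [dos2D_eq_complementaryK h0.ne' (by rwa [abs_of_pos h0]), abs_of_pos h0, Complex.ofReal_div,
    complementaryK_eq_slitK (by positivity), ofReal_div_four]

lemma ofReal_dos2D_eq_dosBranch {e : ℝ} (h0 : 0 < e) (h4 : e < 4) :
    (dos2D e : ℂ) = dosBranch e := by
  rw [ofReal_dos2D h0 h4, dosBranch, ofReal_div_four,
    slitK_eq_rayK_add_arcK (by positivity) (by linarith)]

lemma isUpperContinuation_slitK : IsUpperContinuation fun z => slitK (z / 4) / (2 * π ^ 2 : ℝ) := by
  refine ⟨?_, fun ε h0 h4 => (ofReal_dos2D h0 h4).symm⟩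
  have h1 : DifferentiableOn ℂ (fun z => slitK (z / 4) / (2 * π ^ 2 : ℝ)) Complex.slitPlane := by
    refine (differentiableOn_slitK.comp (by fun_prop) fun z hz => ?_).div_const _
    rw [Complex.mem_slitPlane_iff] at hz ⊢
    rw [show z / 4 = ((4⁻¹ : ℝ) : ℂ) * z by push_cast; ring, Complex.re_ofReal_mul,
      Complex.im_ofReal_mul]
    exact hz.imp (fun h => by positivity) (fun h => by positivity)
  refine (h1.analyticOnNhd Complex.isOpen_slitPlane).mono ?_
  rintro z (hz | hz)
  · exact Or.inr (ne_of_gt hz)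
  · exact Or.inl hz.2.1

/-- Adding an interval of the real line to the open upper half-plane preserves convexity. -/
lemma convex_upperHalfPlane_union :
    Convex ℝ ({z : ℂ | 0 < z.im} ∪ {z : ℂ | z.im = 0 ∧ 0 < z.re ∧ z.re < 4}) := by
  have key {a b : ℝ} (ha : 0 < a) (hb : 0 ≤ b) {y z : ℂ} (hy : 0 < y.im) (hz : 0 ≤ z.im) :
      0 < (a • y + b • z).im := by
    simp only [Complex.add_im, Complex.real_smul, Complex.im_ofReal_mul]
    have := mul_pos ha hy
    have := mul_nonneg hb hz
    linarith
  rw [convex_iff_forall_pos]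
  rintro y (hy | hy) z hz a b ha hb hab
  · exact Or.inl (key ha hb.le hy (hz.elim (fun h => le_of_lt h) fun h => h.1.ge))
  · rcases hz with hz | hz
    · rw [add_comm]
      exact Or.inl (key hb ha.le hz hy.1.ge)
    · refine Or.inr ⟨?_, ?_⟩
      · simp [hy.1, hz.1]
      · have := (convex_Ioo (0 : ℝ) 4) hy.2 hz.2 ha.le hb.le hab
        simpa using this

/-- Supplies the accumulation of agreement points that the identity theorem requires; `2` is just a
convenient interior point of `(0, 4)`. -/
lemma two_frequently_eq {F G : ℂ → ℂ} (h : ∀ ε : ℝ, 0 < ε → ε < 4 → F ε = G ε) :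
    ∃ᶠ z in nhdsWithin (2 : ℂ) {2}ᶜ, F z = G z := by
  have h1 : Filter.Tendsto (fun x : ℝ => (x : ℂ)) (nhdsWithin 2 {2}ᶜ) (nhdsWithin (2 : ℂ) {2}ᶜ) := by
    refine tendsto_nhdsWithin_iff.mpr ⟨?_, ?_⟩
    · exact (Complex.continuous_ofReal.tendsto' 2 2 (by norm_num)).mono_left nhdsWithin_le_nhds
    · filter_upwards [self_mem_nhdsWithin] with x hx
      simpa using fun h => hx (by exact_mod_cast h)
  refine h1.frequently (Filter.Eventually.frequently ?_)
  filter_upwards [nhdsWithin_le_nhds (Ioo_mem_nhds (by norm_num : (0 : ℝ) < 2)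
    (by norm_num : (2 : ℝ) < 4))] with x hx
  exact h x hx.1 hx.2

lemma IsUpperContinuation.eq {F G : ℂ → ℂ} (hF : IsUpperContinuation F)
    (hG : IsUpperContinuation G) {z : ℂ} (hz : 0 < z.im) : F z = G z := by
  refine hF.1.eqOn_of_preconnected_of_frequently_eq hG.1 convex_upperHalfPlane_union.isPreconnected
    (z₀ := 2) (Or.inr (by norm_num)) (two_frequently_eq fun ε h0 h4 => ?_) (Or.inl hz)
  rw [hF.2 ε h0 h4, hG.2 ε h0 h4]

/-- The identity theorem again, now on the convex part of the domain inside the disc of radius `4`,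
to which `dosBranch` is confined. -/
lemma IsUpperContinuation.eqOn_dosBranch {F : ℂ → ℂ} (hF : IsUpperContinuation F) :
    EqOn F dosBranch {z | 0 < z.im ∧ ‖z‖ < 4} := by
  set S : Set ℂ := ({z : ℂ | 0 < z.im} ∪ {z : ℂ | z.im = 0 ∧ 0 < z.re ∧ z.re < 4}) ∩
    Metric.ball 0 4 with hS
  have hsub : S ⊆ slitDisc 4 := by
    rintro z ⟨hz, hz4⟩
    refine ⟨by simpa using hz4, ?_⟩
    rw [Complex.mem_slitPlane_iff]
    rcases hz with hz | hz
    · exact Or.inl (by simpa using hz)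
    · exact Or.inr (by simpa using hz.2.1.ne')
  have hconv : IsPreconnected S := (convex_upperHalfPlane_union.inter (convex_ball 0 4)).isPreconnected
  have h2 : (2 : ℂ) ∈ S := ⟨Or.inr (by norm_num), by norm_num⟩
  have h := (hF.1.mono inter_subset_left).eqOn_of_preconnected_of_frequently_eq
    ((differentiableOn_dosBranch.analyticOnNhd (isOpen_slitDisc 4)).mono hsub) hconv h2
    (two_frequently_eq fun ε h0 h4 => by rw [hF.2 ε h0 h4, ofReal_dos2D_eq_dosBranch h0 h4])
  exact fun z hz => h ⟨Or.inl hz.1, by simpa using hz.2⟩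

/-! ### Integrable majorants on the chord and the semicircle -/

lemma intervalIntegrable_inv_sqrt_abs (a b : ℝ) :
    IntervalIntegrable (fun x : ℝ => (√|x|)⁻¹) volume a b := by
  refine intervalIntegrable_of_even (fun x => by rw [abs_neg]) (fun x hx => ?_)
  refine (intervalIntegral.intervalIntegrable_rpow' (r := -(1 / 2)) (by norm_num)).congr ?_
  intro y hy
  rw [uIoc_of_le hx.le] at hy
  simp only
  rw [Real.rpow_neg hy.1.le, ← Real.sqrt_eq_rpow, abs_of_pos hy.1]

lemma intervalIntegrable_inv_sqrt_abs_add_mul {t : ℝ} (ht : 0 < t) (e a b : ℝ) :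
    IntervalIntegrable (fun x : ℝ => (√|e + t * x|)⁻¹) volume a b := by
  have h := (intervalIntegrable_inv_sqrt_abs (t * a + e) (t * b + e)).comp_add_right e
  rw [add_sub_cancel_right, add_sub_cancel_right] at h
  have h2 := h.comp_mul_left (c := t)
  rw [mul_div_cancel_left₀ _ ht.ne', mul_div_cancel_left₀ _ ht.ne'] at h2
  simpa only [add_comm] using h2

lemma intervalIntegrable_inv_sqrt_four_sub (a b : ℝ) :
    IntervalIntegrable (fun x : ℝ => (√(4 - x ^ 2))⁻¹) volume a b := by
  refine ((intervalIntegrable_arcsineDensity a b).mul_const π).congr fun x _ => ?_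
  simp only [arcsineDensity]
  field_simp

/-- Two inverse square root singularities at different points have an integrable product. -/
lemma intervalIntegrable_inv_sqrt_mul {t e : ℝ} (ht : 0 < t) (he : |e| < 2 * t) :
    IntervalIntegrable (fun x : ℝ => (√|e + t * x|)⁻¹ * (√(4 - x ^ 2))⁻¹) volume (-2) 2 := by
  set d := (2 * t - |e|) / 2 with hd
  have hd0 : 0 < d := by rw [hd]; linarith
  refine IntervalIntegrable.mono_fun
    (f := fun x => (√|e + t * x|)⁻¹ * (√(2 * (d / t)))⁻¹ + (√d)⁻¹ * (√(4 - x ^ 2))⁻¹)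
    (((intervalIntegrable_inv_sqrt_abs_add_mul ht e _ _).mul_const _).add
      ((intervalIntegrable_inv_sqrt_four_sub _ _).const_mul _))
    (Measurable.aestronglyMeasurable (by fun_prop)) ?_
  refine (ae_restrict_mem measurableSet_uIoc).mono fun x hx => ?_
  rw [uIoc_of_le (by norm_num)] at hx
  beta_reduce
  rw [Real.norm_of_nonneg (by positivity), Real.norm_of_nonneg (by positivity)]
  -- Near the interior singularity `2 - |x| ≥ d / t`, so the endpoint factor is bounded; elsewhere
  -- the interior factor is.
  rcases le_or_gt |e + t * x| d with h | h
  · refine le_add_of_le_of_nonneg ?_ (by positivity)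
    have h1 : t * |x| ≤ 2 * t - d := by
      have h2 := abs_sub (e + t * x) e
      rw [add_sub_cancel_left, abs_mul, abs_of_pos ht] at h2
      linarith
    have h3 : d / t ≤ 2 - |x| := by
      rw [div_le_iff₀ ht]
      linarith
    have h4 : 0 < d / t := by positivity
    gcongr
    nlinarith [abs_nonneg x, sq_abs x]
  · refine le_add_of_nonneg_of_le (by positivity) ?_
    gcongr

/-- The parabola is `4 - x²` pulled back along the affine map `[0, π] → [-2, 2]`; comparison reduces
the integrability of `1 / √sin` to that of the arcsine density. -/
lemma sin_lower_bound {θ : ℝ} (h0 : 0 ≤ θ) (hπ : θ ≤ π) :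
    (4 - (4 / π * θ + -2) ^ 2) / 8 ≤ Real.sin θ := by
  have hpi := Real.pi_pos
  have h1 : (4 - (4 / π * θ + -2) ^ 2) / 8 = 2 / π * θ * ((π - θ) / π) := by
    field_simp
    ring
  rw [h1]
  rcases le_total θ (π / 2) with h | h
  · refine (mul_le_of_le_one_right (by positivity) ?_).trans (Real.mul_le_sin h0 h)
    rw [div_le_one hpi]
    linarith
  · rw [← Real.sin_pi_sub]
    refine le_trans ?_ (Real.mul_le_sin (by linarith) (by linarith))
    have h2 : 2 / π * θ * ((π - θ) / π) = 2 / π * (π - θ) * (θ / π) := by ring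
    rw [h2]
    refine mul_le_of_le_one_right (mul_nonneg (by positivity) (by linarith)) ?_
    rw [div_le_one hpi]
    exact hπ

lemma integrableOn_inv_sqrt_sin :
    IntegrableOn (fun θ => (√(8 * Real.sin θ))⁻¹) (Ioo 0 π) := by
  have hpi := Real.pi_pos
  have h := ((intervalIntegrable_inv_sqrt_four_sub (-2) 2).comp_add_right (-2)).comp_mul_left
    (c := 4 / π)
  rw [show (-2 - -2 : ℝ) / (4 / π) = 0 by norm_num,
    show (2 - -2 : ℝ) / (4 / π) = π by field_simp; norm_num,
    intervalIntegrable_iff_integrableOn_Ioo_of_le hpi.le] at h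
  refine Integrable.mono' h (Measurable.aestronglyMeasurable (by fun_prop)) ?_
  refine (ae_restrict_mem measurableSet_Ioo).mono fun θ hθ => ?_
  rw [Real.norm_of_nonneg (by positivity)]
  have h1 := sin_lower_bound hθ.1.le hθ.2.le
  have h2 : 0 < 4 - (4 / π * θ + -2) ^ 2 := by
    have h3 : 4 - (4 / π * θ + -2) ^ 2 = 16 / π ^ 2 * θ * (π - θ) := by
      field_simp
      ring
    have h4 := hθ.1
    have h5 : 0 < π - θ := by linarith [hθ.2]
    rw [h3]
    positivity
  gcongr
  linarith

lemma norm_four_sub_sq (u : ℂ) : ‖4 - u ^ 2‖ = ‖2 - u‖ * ‖2 + u‖ := by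
  rw [← norm_mul]
  congr 1
  ring

lemma circleMap_two_re (θ : ℝ) : (circleMap 0 2 θ).re = 2 * Real.cos θ := by
  simp [circleMap_zero, Complex.exp_ofReal_mul_I_re]

lemma circleMap_two_im (θ : ℝ) : (circleMap 0 2 θ).im = 2 * Real.sin θ := by
  simp [circleMap_zero, Complex.exp_ofReal_mul_I_im]

/-- On the semicircle `|2 ∓ u|² = 8 (1 ∓ cos θ)`, with product `(8 sin θ)²`; an upward shift only
increases both distances. The bound is thus uniform in `δ`. -/
lemma le_norm_four_sub_sq_arc {θ δ : ℝ} (hθ : 0 ≤ Real.sin θ) (hδ : 0 ≤ δ) :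
    8 * Real.sin θ ≤ ‖4 - (circleMap 0 2 θ + δ * Complex.I) ^ 2‖ := by
  have hsc := Real.sin_sq_add_cos_sq θ
  have h1 : 8 * (1 - Real.cos θ) ≤ ‖2 - (circleMap 0 2 θ + δ * Complex.I)‖ ^ 2 := by
    rw [← Complex.normSq_eq_norm_sq, Complex.normSq_apply]
    simp only [Complex.sub_re, Complex.sub_im, Complex.add_re, Complex.add_im, circleMap_two_re,
      circleMap_two_im, Complex.re_ofReal_mul, Complex.im_ofReal_mul, Complex.I_re, Complex.I_im,
      Complex.re_ofNat, Complex.im_ofNat]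
    nlinarith [mul_nonneg hθ hδ, sq_nonneg δ]
  have h2 : 8 * (1 + Real.cos θ) ≤ ‖2 + (circleMap 0 2 θ + δ * Complex.I)‖ ^ 2 := by
    rw [← Complex.normSq_eq_norm_sq, Complex.normSq_apply]
    simp only [Complex.add_re, Complex.add_im, circleMap_two_re,
      circleMap_two_im, Complex.re_ofReal_mul, Complex.im_ofReal_mul, Complex.I_re, Complex.I_im,
      Complex.re_ofNat, Complex.im_ofNat]
    nlinarith [mul_nonneg hθ hδ, sq_nonneg δ]
  rw [norm_four_sub_sq]
  refine le_of_sq_le_sq ?_ (by positivity)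
  rw [mul_pow ‖2 - _‖]
  calc (8 * Real.sin θ) ^ 2 = 8 * (1 - Real.cos θ) * (8 * (1 + Real.cos θ)) := by nlinarith
    _ ≤ _ := mul_le_mul h1 h2 (by linarith [Real.neg_one_le_cos θ]) (by positivity)

lemma le_norm_four_sub_sq_chord {x : ℝ} (hx : -2 ≤ x) (δ : ℝ) :
    4 - x ^ 2 ≤ ‖4 - (x + δ * Complex.I) ^ 2‖ := by
  have h1 : 2 - x ≤ ‖2 - (x + δ * Complex.I)‖ := by
    refine le_trans (le_of_eq ?_) (Complex.re_le_norm _)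
    simp
  have h2 : 2 + x ≤ ‖2 + (x + δ * Complex.I)‖ := by
    refine le_trans (le_of_eq ?_) (Complex.re_le_norm _)
    simp
  rw [norm_four_sub_sq]
  calc 4 - x ^ 2 = (2 - x) * (2 + x) := by ring
    _ ≤ _ := mul_le_mul h1 h2 (by linarith) (by positivity)

/-- The imaginary part `-2xy` vanishes only for `x = 0`, and then the real part is `4 + y² > 0`. -/
lemma four_sub_sq_mem_slitPlane {u : ℂ} (hu : 0 < u.im) : 4 - u ^ 2 ∈ Complex.slitPlane := by
  rw [Complex.mem_slitPlane_iff]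
  simp only [pow_two, Complex.sub_re, Complex.mul_re, Complex.sub_im, Complex.mul_im,
    Complex.re_ofNat, Complex.im_ofNat]
  by_cases h : u.re = 0
  · left
    rw [h]
    nlinarith
  · right
    have := mul_ne_zero h hu.ne'
    intro h2
    apply this
    linarith

lemma mem_slitDisc_of_im_pos {p : ℂ} {R : ℝ} (h0 : 0 < p.im) (h1 : ‖p‖ < R) : p ∈ slitDisc R :=
  ⟨h1, mem_slitPlane_of_re_pos (by simpa using h0)⟩

/-- If `e + v` lay on the slit, then `e.re = -v.re` and `e.im ≤ -v.im ≤ 0`, forcing `‖e‖ ≥ ‖v‖`. -/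
lemma add_mem_slitDisc {e v : ℂ} {R : ℝ} (hv : 0 ≤ v.im) (hev : ‖e‖ < ‖v‖)
    (hR : ‖e‖ + ‖v‖ < R) : e + v ∈ slitDisc R := by
  refine ⟨(norm_add_le e v).trans_lt hR, ?_⟩
  by_contra h
  rw [Complex.mem_slitPlane_iff, not_or, not_lt, not_not] at h
  simp only [Complex.mul_re, Complex.neg_re, Complex.I_re, Complex.neg_im, Complex.I_im,
    Complex.add_re, Complex.add_im, Complex.mul_im] at h
  have h1 : e.re = -v.re := by linarith [h.2]
  have h2 : v.im ≤ -e.im := by linarith [h.1]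
  have h3 : ‖v‖ ^ 2 ≤ ‖e‖ ^ 2 := by
    rw [← Complex.normSq_eq_norm_sq, ← Complex.normSq_eq_norm_sq, Complex.normSq_apply,
      Complex.normSq_apply, h1]
    nlinarith
  exact absurd (le_of_sq_le_sq h3 (norm_nonneg _)) (not_le.mpr hev)

/-- The shifted semicircle of radius `2 t` about `e` lies in the slit disc of radius `4`. -/
lemma add_mul_circleMap_mem_slitDisc {t θ δ : ℝ} {e : ℂ} (ht : 0 < t) (hθ : 0 ≤ Real.sin θ)
    (hδ : 0 ≤ δ) (h1 : ‖e‖ < 2 * t) (h2 : ‖e‖ + t * (2 + δ) < 4) :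
    e + t * (circleMap 0 2 θ + δ * Complex.I) ∈ slitDisc 4 := by
  have h3 : 2 ≤ ‖circleMap 0 2 θ + δ * Complex.I‖ := by
    refine le_of_sq_le_sq ?_ (norm_nonneg _)
    rw [← Complex.normSq_eq_norm_sq, Complex.normSq_apply]
    simp only [Complex.add_re, Complex.add_im, circleMap_two_re,
      circleMap_two_im, Complex.re_ofReal_mul, Complex.im_ofReal_mul, Complex.I_re, Complex.I_im]
    nlinarith [mul_nonneg hθ hδ, sq_nonneg δ, Real.sin_sq_add_cos_sq θ]
  have h4 : ‖circleMap 0 2 θ + δ * Complex.I‖ ≤ 2 + δ := by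
    refine (norm_add_le _ _).trans (le_of_eq ?_)
    rw [norm_mul, Complex.norm_I, mul_one, Complex.norm_real, Real.norm_of_nonneg hδ,
      norm_circleMap_zero, abs_of_pos (by norm_num : (0 : ℝ) < 2)]
  have h5 : ‖(t : ℂ) * (circleMap 0 2 θ + δ * Complex.I)‖ =
      t * ‖circleMap 0 2 θ + δ * Complex.I‖ := by
    rw [norm_mul, Complex.norm_real, Real.norm_of_nonneg ht.le]
  refine add_mem_slitDisc ?_ ?_ ?_
  · rw [Complex.im_ofReal_mul, Complex.add_im, circleMap_two_im, Complex.im_ofReal_mul,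
      Complex.I_im]
    positivity
  · rw [h5]
    nlinarith
  · rw [h5]
    nlinarith

/-! ### Averages over the semicircle -/

/-- The weight of the semicircle in the parametrization by the angle. -/
noncomputable def arcWeight (θ : ℝ) : ℂ :=
  deriv (circleMap 0 2) θ * invSqrt (4 - circleMap 0 2 θ ^ 2) / π

/-- The average of `φ (e + t u)` over the semicircle of radius `2`. -/
noncomputable def arcAverage (φ : ℂ → ℂ) (t : ℝ) (e : ℂ) : ℂ :=
  semicircleIntegral fun u => φ (e + t * u) / (4 - u ^ 2) ^ (1 / 2 : ℂ) / π

lemma div_cpow_half (z w : ℂ) : z / w ^ (1 / 2 : ℂ) = z * invSqrt w := by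
  rw [invSqrt, Complex.cpow_neg, div_eq_mul_inv]

lemma semicircleIntegrand_eq (φ : ℂ → ℂ) (θ : ℝ) :
    semicircleIntegrand (fun u => φ u / (4 - u ^ 2) ^ (1 / 2 : ℂ) / π) θ =
      φ (circleMap 0 2 θ) * arcWeight θ := by
  rw [semicircleIntegrand, div_cpow_half, arcWeight]
  ring

lemma semicircleIntegral_eq (φ : ℂ → ℂ) :
    semicircleIntegral (fun u => φ u / (4 - u ^ 2) ^ (1 / 2 : ℂ) / π) =
      -∫ θ in Ioo 0 π, φ (circleMap 0 2 θ) * arcWeight θ := by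
  simp only [semicircleIntegral, semicircleIntegrand_eq]
  rw [intervalIntegral.integral_symm, intervalIntegral.integral_of_le Real.pi_pos.le,
    integral_Ioc_eq_integral_Ioo]

lemma measurable_arcWeight : Measurable arcWeight := by
  have := measurable_invSqrt
  unfold arcWeight
  simp only [deriv_circleMap]
  have h : Measurable (circleMap 0 2) := (continuous_circleMap 0 2).measurable
  fun_prop

lemma norm_deriv_circleMap_two (θ : ℝ) : ‖deriv (circleMap 0 2) θ‖ = 2 := by
  rw [deriv_circleMap, norm_mul, norm_circleMap_zero, Complex.norm_I]
  norm_num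

lemma norm_arcWeight_le {θ : ℝ} (hθ : θ ∈ Ioo 0 π) :
    ‖arcWeight θ‖ ≤ 2 * (√(8 * Real.sin θ))⁻¹ / π := by
  have hs := Real.sin_pos_of_mem_Ioo hθ
  have h := le_norm_four_sub_sq_arc hs.le le_rfl
  rw [Complex.ofReal_zero, zero_mul, add_zero] at h
  rw [arcWeight, norm_div, norm_mul, norm_deriv_circleMap_two, Complex.norm_real,
    Real.norm_of_nonneg Real.pi_pos.le]
  have := norm_invSqrt_le (by positivity) h
  gcongr

/-- A function on the slit disc is bounded near the shifted semicircles about points near `e`. -/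
lemma exists_bound_near_semicircle {φ : ℂ → ℂ} (hφ : ContinuousOn φ (slitDisc 4)) {t : ℝ}
    (ht : 0 < t) {e : ℂ} (h1 : ‖e‖ < 2 * t) (h2 : ‖e‖ + 2 * t < 4) :
    ∃ η > 0, ∃ M, ∀ z ∈ Metric.closedBall e η, ∀ θ ∈ Icc 0 π, ∀ δ ∈ Icc 0 η,
      z + t * (circleMap 0 2 θ + (δ : ℝ) * Complex.I) ∈ slitDisc 4 ∧
      ‖φ (z + t * (circleMap 0 2 θ + (δ : ℝ) * Complex.I))‖ ≤ M := by
  -- The first entry keeps `‖z‖ < 2 * t`; the second keeps `‖z‖ + t * (2 + δ) < 4` when both the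
  -- displacement of `z` and `δ` are at most `η`.
  set η := min ((2 * t - ‖e‖) / 2) ((4 - ‖e‖ - 2 * t) / (2 * (1 + t))) with hη
  have hη0 : 0 < η := lt_min (by linarith) (div_pos (by linarith) (by linarith))
  have hη1 : η ≤ (2 * t - ‖e‖) / 2 := min_le_left _ _
  have hη2 : η * (2 * (1 + t)) ≤ 4 - ‖e‖ - 2 * t :=
    (le_div_iff₀ (by linarith)).mp (min_le_right _ _)
  have hmem : ∀ z ∈ Metric.closedBall e η, ∀ θ ∈ Icc 0 π, ∀ δ ∈ Icc 0 η,
      z + t * (circleMap 0 2 θ + (δ : ℝ) * Complex.I) ∈ slitDisc 4 := by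
    intro z hz θ hθ δ hδ
    have hz' : ‖z‖ ≤ ‖e‖ + η := by
      rw [mem_closedBall_iff_norm] at hz
      have := norm_add_le e (z - e)
      rw [add_sub_cancel] at this
      linarith
    refine add_mul_circleMap_mem_slitDisc ht (Real.sin_nonneg_of_mem_Icc hθ) hδ.1 (by linarith) ?_
    nlinarith [mul_le_mul_of_nonneg_left hδ.2 ht.le]
  have hK : IsCompact ((Metric.closedBall e η) ×ˢ (Icc 0 π ×ˢ Icc 0 η)) :=
    (isCompact_closedBall e η).prod (isCompact_Icc.prod isCompact_Icc)
  have hc : Continuous fun p : ℂ × ℝ × ℝ =>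
      p.1 + t * (circleMap 0 2 p.2.1 + (p.2.2 : ℝ) * Complex.I) := by
    have := continuous_circleMap 0 2
    fun_prop
  obtain ⟨M, hM⟩ := hK.exists_bound_of_continuousOn (f := fun p : ℂ × ℝ × ℝ =>
      φ (p.1 + t * (circleMap 0 2 p.2.1 + (p.2.2 : ℝ) * Complex.I)))
    (hφ.comp hc.continuousOn fun p hp => hmem p.1 hp.1 p.2.1 hp.2.1 p.2.2 hp.2.2)
  exact ⟨η, hη0, M, fun z hz θ hθ δ hδ => ⟨hmem z hz θ hθ δ hδ, hM (z, θ, δ) ⟨hz, hθ, hδ⟩⟩⟩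

lemma aestronglyMeasurable_comp_circleMap {φ : ℂ → ℂ} (hφ : ContinuousOn φ (slitDisc 4)) {t : ℝ}
    {e w : ℂ} (h : ∀ θ ∈ Icc 0 π, e + t * (circleMap 0 2 θ + w) ∈ slitDisc 4) :
    AEStronglyMeasurable (fun θ => φ (e + t * (circleMap 0 2 θ + w)))
      (volume.restrict (Ioo 0 π)) := by
  refine ContinuousOn.aestronglyMeasurable (hφ.comp ?_ fun θ hθ => h θ (Ioo_subset_Icc_self hθ))
    measurableSet_Ioo
  have := continuous_circleMap 0 2
  fun_prop

/-- On the semicircle `φ` is bounded uniformly for nearby `e`, so only the integrable weight is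
singular. Applied to iterated derivatives, the first conjunct also gives the absolute convergence in
the theorem. -/
lemma hasDerivAt_arcAverage {φ : ℂ → ℂ} (hφ : DifferentiableOn ℂ φ (slitDisc 4)) {t : ℝ}
    (ht : 0 < t) {e : ℂ} (h1 : ‖e‖ < 2 * t) (h2 : ‖e‖ + 2 * t < 4) :
    IntegrableOn (fun θ => φ (e + t * circleMap 0 2 θ) * arcWeight θ) (Ioo 0 π) ∧
    HasDerivAt (arcAverage φ t) (arcAverage (deriv φ) t e) e := by
  obtain ⟨η, hη, M, hM⟩ := exists_bound_near_semicircle hφ.continuousOn ht h1 h2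
  have hV := Metric.closedBall_mem_nhds e hη
  have hM' : ∀ z ∈ Metric.closedBall e η, ∀ θ ∈ Icc 0 π,
      z + t * circleMap 0 2 θ ∈ slitDisc 4 ∧ ‖φ (z + t * circleMap 0 2 θ)‖ ≤ M := by
    intro z hz θ hθ
    simpa using hM z hz θ hθ 0 ⟨le_rfl, hη.le⟩
  have hmeas : ∀ z ∈ Metric.closedBall e η,
      AEStronglyMeasurable (fun θ => φ (z + t * circleMap 0 2 θ) * arcWeight θ)
        (volume.restrict (Ioo 0 π)) := by
    intro z hz
    have := aestronglyMeasurable_comp_circleMap hφ.continuousOn (t := t) (e := z) (w := 0)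
      (fun θ hθ => by simpa using (hM' z hz θ hθ).1)
    simp only [add_zero] at this
    exact this.mul measurable_arcWeight.aestronglyMeasurable
  have hbound : ∀ᵐ θ ∂(volume.restrict (Ioo 0 π)), ∀ z ∈ Metric.closedBall e η,
      ‖φ (z + t * circleMap 0 2 θ) * arcWeight θ‖ ≤ M * (2 * (√(8 * Real.sin θ))⁻¹ / π) := by
    refine (ae_restrict_mem measurableSet_Ioo).mono fun θ hθ z hz => ?_
    have h3 := (hM' z hz θ (Ioo_subset_Icc_self hθ)).2
    rw [norm_mul]
    exact mul_le_mul h3 (norm_arcWeight_le hθ) (norm_nonneg _) ((norm_nonneg _).trans h3)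
  have hint : IntegrableOn (fun θ => M * (2 * (√(8 * Real.sin θ))⁻¹ / π)) (Ioo 0 π) :=
    ((integrableOn_inv_sqrt_sin.const_mul 2).div_const π).const_mul M
  refine ⟨hint.mono' (hmeas e (Metric.mem_closedBall_self hη.le))
    (hbound.mono fun θ h => h e (Metric.mem_closedBall_self hη.le)), ?_⟩
  have hderiv {θ : ℝ} {z : ℂ} (h : z + t * circleMap 0 2 θ ∈ slitDisc 4) :
      HasDerivAt (fun z => φ (z + t * circleMap 0 2 θ) * arcWeight θ)
        (deriv φ (z + t * circleMap 0 2 θ) * arcWeight θ) z :=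
    ((hφ.differentiableAt ((isOpen_slitDisc 4).mem_nhds h)).hasDerivAt.comp_add_const
      z _).mul_const _
  have key := hasDerivAt_integral_of_locally_dominated hV
    (f := fun z θ => φ (z + t * circleMap 0 2 θ) * arcWeight θ) hmeas
    ((ae_restrict_mem measurableSet_Ioo).mono fun θ hθ z hz =>
      (hderiv (hM' z hz θ (Ioo_subset_Icc_self hθ)).1).differentiableAt) hbound hint
  have h3 : arcAverage φ t = fun z => -∫ θ in Ioo 0 π, φ (z + t * circleMap 0 2 θ) * arcWeight θ :=
    funext fun z => semicircleIntegral_eq fun u => φ (z + t * u)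
  have h4 : arcAverage (deriv φ) t e =
      -∫ θ in Ioo 0 π, deriv φ (e + t * circleMap 0 2 θ) * arcWeight θ :=
    semicircleIntegral_eq fun u => deriv φ (e + t * u)
  rw [h3, h4]
  refine key.neg.congr_deriv ?_
  congr 1
  refine setIntegral_congr_fun measurableSet_Ioo fun θ hθ => ?_
  exact (hderiv (hM' e (Metric.mem_closedBall_self hη.le) θ (Ioo_subset_Icc_self hθ)).1).deriv

/-- Deformation of a chord to a semicircle inside a convex domain of holomorphy. -/
lemma integral_arc_eq_integral_chord {g : ℂ → ℂ} {U : Set ℂ} (hU : Convex ℝ U) (hUo : IsOpen U)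
    (hg : DifferentiableOn ℂ g U) {w : ℂ} (harc : ∀ θ ∈ Icc 0 π, circleMap 0 2 θ + w ∈ U) :
    ∫ θ in π..0, deriv (circleMap 0 2) θ * g (circleMap 0 2 θ + w) =
      ∫ x in (-2 : ℝ)..2, g (x + w) := by
  obtain ⟨G, hG⟩ := hU.exists_forall_hasDerivWithinAt hg
  have hG' {u : ℂ} (hu : u ∈ U) : HasDerivAt G (g u) u := (hG u hu).hasDerivAt (hUo.mem_nhds hu)
  have hpi := Real.pi_pos
  have e0 : circleMap 0 2 0 = 2 := by simp [circleMap]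
  have eπ : circleMap 0 2 π = -2 := by simp [circleMap]
  have hchord : ∀ x ∈ Icc (-2 : ℝ) 2, (x : ℂ) + w ∈ U := by
    intro x hx
    have h0 := harc 0 ⟨le_rfl, hpi.le⟩
    have hπ := harc π ⟨hpi.le, le_rfl⟩
    rw [e0] at h0
    rw [eπ] at hπ
    have := hU h0 hπ (a := (2 + x) / 4) (b := (2 - x) / 4) (by linarith [hx.1]) (by linarith [hx.2])
      (by ring)
    convert this using 1
    simp only [Complex.real_smul]
    push_cast
    ring
  rw [intervalIntegral.integral_eq_sub_of_hasDerivAt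
      (f := fun θ => G (circleMap 0 2 θ + w)), intervalIntegral.integral_eq_sub_of_hasDerivAt
      (f := fun x : ℝ => G (x + w))]
  · rw [e0, eπ]
    push_cast
    rfl
  · intro x hx
    rw [uIcc_of_le (by norm_num)] at hx
    exact ((hG' (hchord x hx)).comp_add_const (x : ℂ) w).comp_ofReal
  · refine ContinuousOn.intervalIntegrable (hg.continuousOn.comp (by fun_prop) ?_)
    rwa [uIcc_of_le (by norm_num)]
  · intro θ hθ
    rw [uIcc_of_ge hpi.le] at hθ
    have h := (hG' (harc θ hθ)).comp_add_const (circleMap 0 2 θ) w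
    have h2 := HasDerivAt.comp_of_eq θ h (differentiable_circleMap 0 2 θ).hasDerivAt rfl
    rw [mul_comm]
    exact h2
  · refine ContinuousOn.intervalIntegrable (ContinuousOn.mul ?_ (hg.continuousOn.comp ?_ ?_))
    · simp only [funext (deriv_circleMap 0 2)]
      exact ((continuous_circleMap 0 2).mul continuous_const).continuousOn
    · exact ((continuous_circleMap 0 2).add continuous_const).continuousOn
    · rwa [uIcc_of_ge hpi.le]

lemma integral_pi_zero_eq (f : ℝ → ℂ) : ∫ θ in π..0, f θ = -∫ θ in Ioo 0 π, f θ := by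
  rw [intervalIntegral.integral_symm, intervalIntegral.integral_of_le Real.pi_pos.le,
    integral_Ioc_eq_integral_Ioo]

lemma arcAverage_eq (φ : ℂ → ℂ) (t : ℝ) (e : ℂ) : arcAverage φ t e =
    (∫ θ in π..0, deriv (circleMap 0 2) θ *
      (φ (e + t * circleMap 0 2 θ) * invSqrt (4 - circleMap 0 2 θ ^ 2))) / π := by
  rw [arcAverage, semicircleIntegral_eq fun u => φ (e + t * u), integral_pi_zero_eq, neg_div,
    ← integral_div]
  congr 2
  ext θ
  rw [arcWeight]
  ring

lemma tendsto_ofReal_mul_I : Filter.Tendsto (fun δ : ℝ => (δ : ℂ) * Complex.I)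
    (nhdsWithin 0 (Ioi 0)) (nhds 0) := by
  have h : Continuous fun δ : ℝ => (δ : ℂ) * Complex.I := by fun_prop
  exact (h.tendsto' 0 0 (by simp)).mono_left nhdsWithin_le_nhds

lemma tendsto_comp_shift {g : ℂ → ℂ} {u : ℂ} (hg : ContinuousAt g u) :
    Filter.Tendsto (fun δ : ℝ => g (u + (δ : ℝ) * Complex.I)) (nhdsWithin 0 (Ioi 0))
      (nhds (g u)) := by
  have h : Filter.Tendsto (fun δ : ℝ => u + (δ : ℂ) * Complex.I) (nhdsWithin 0 (Ioi 0))
      (nhds (u + 0)) := tendsto_ofReal_mul_I.const_add u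
  rw [add_zero] at h
  exact hg.tendsto.comp h

/-! ### From the chord to the semicircle -/

section Deformation

variable {φ : ℂ → ℂ} {t e : ℝ}

lemma tendsto_integral_shifted_arc (hφ : DifferentiableOn ℂ φ (slitDisc 4)) (ht : 0 < t)
    (h1 : |e| < 2 * t) (h2 : |e| + 2 * t < 4) :
    Filter.Tendsto (fun δ : ℝ => ∫ θ in π..0, deriv (circleMap 0 2) θ *
      (φ (e + t * (circleMap 0 2 θ + (δ : ℝ) * Complex.I)) *
        invSqrt (4 - (circleMap 0 2 θ + (δ : ℝ) * Complex.I) ^ 2))) (nhdsWithin 0 (Ioi 0))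
      (nhds (∫ θ in π..0, deriv (circleMap 0 2) θ *
        (φ (e + t * circleMap 0 2 θ) * invSqrt (4 - circleMap 0 2 θ ^ 2)))) := by
  have he : ‖(e : ℂ)‖ = |e| := by rw [Complex.norm_real, Real.norm_eq_abs]
  obtain ⟨η, hη, M, hM⟩ := exists_bound_near_semicircle hφ.continuousOn ht (e := (e : ℂ))
    (by rwa [he]) (by rwa [he])
  have hself := Metric.mem_closedBall_self (x := (e : ℂ)) hη.le
  simp only [integral_pi_zero_eq]
  refine Filter.Tendsto.neg ?_
  have hev : ∀ᶠ δ : ℝ in nhdsWithin 0 (Ioi 0), δ ∈ Icc 0 η :=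
    Filter.mem_of_superset (Ioo_mem_nhdsGT hη) Ioo_subset_Icc_self
  refine tendsto_integral_filter_of_dominated_convergence
    (fun θ => 2 * (M * (√(8 * Real.sin θ))⁻¹)) ?_ ?_
    ((integrableOn_inv_sqrt_sin.const_mul M).const_mul 2) ?_
  · filter_upwards [hev] with δ hδ
    have hm := measurable_invSqrt
    have hc : Measurable (circleMap 0 2) := (continuous_circleMap 0 2).measurable
    have hd : Measurable (deriv (circleMap 0 2)) := by
      rw [funext (deriv_circleMap 0 2)]
      fun_prop
    refine hd.aestronglyMeasurable.mul ((aestronglyMeasurable_comp_circleMap hφ.continuousOn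
      fun θ hθ => (hM _ hself θ hθ δ hδ).1).mul ?_)
    exact Measurable.aestronglyMeasurable (by fun_prop)
  · filter_upwards [hev] with δ hδ
    refine (ae_restrict_mem measurableSet_Ioo).mono fun θ hθ => ?_
    have hs := Real.sin_pos_of_mem_Ioo hθ
    have h3 := (hM _ hself θ (Ioo_subset_Icc_self hθ) δ hδ).2
    rw [norm_mul, norm_mul, norm_deriv_circleMap_two]
    have h4 := norm_invSqrt_le (by positivity) (le_norm_four_sub_sq_arc hs.le hδ.1)
    have h5 := mul_le_mul h3 h4 (norm_nonneg _) ((norm_nonneg _).trans h3)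
    linarith
  · refine (ae_restrict_mem measurableSet_Ioo).mono fun θ hθ => ?_
    refine Filter.Tendsto.const_mul _ (tendsto_comp_shift
      (g := fun u => φ (e + t * u) * invSqrt (4 - u ^ 2)) ?_)
    have h3 := (hM _ hself θ (Ioo_subset_Icc_self hθ) 0 ⟨le_rfl, hη.le⟩).1
    rw [Complex.ofReal_zero, zero_mul, add_zero] at h3
    have h4 : DifferentiableAt ℂ (fun u : ℂ => φ (e + t * u)) (circleMap 0 2 θ) :=
      DifferentiableAt.comp (circleMap 0 2 θ)
        (hφ.differentiableAt ((isOpen_slitDisc 4).mem_nhds h3)) (by fun_prop)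
    have h5 : DifferentiableAt ℂ (fun u : ℂ => invSqrt (4 - u ^ 2)) (circleMap 0 2 θ) :=
      DifferentiableAt.invSqrt (by fun_prop) (four_sub_sq_mem_slitPlane
        (by rw [circleMap_two_im]; have := Real.sin_pos_of_mem_Ioo hθ; positivity))
    exact (h4.fun_mul h5).continuousAt

lemma abs_add_mul_le {x : ℝ} (ht : 0 < t) (hx : x ∈ Icc (-2) 2) :
    |e + t * x| ≤ |e| + 2 * t := by
  have h3 : |t * x| ≤ 2 * t := by
    rw [abs_mul, abs_of_pos ht]
    nlinarith [abs_le.mpr hx]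
  exact (abs_add_le _ _).trans (by linarith)

lemma ae_add_mul_ne_zero (ht : 0 < t) : ∀ᵐ x : ℝ, e + t * x ≠ 0 := by
  have : ∀ᵐ x : ℝ, x ∉ ({-e / t} : Set ℝ) :=
    measure_eq_zero_iff_ae_notMem.mp (measure_singleton _)
  filter_upwards [this] with x hx h
  apply hx
  rw [mem_singleton_iff, eq_div_iff ht.ne']
  linarith

/-- A majorant independent of the upward shift `δ`: the real part of the argument is unchanged, so
its modulus is at least `|e + t * x|`. The range of `δ` keeps the argument within the midpoint of
`|e| + 2 * t` and `4`. -/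
lemma norm_shifted_chord_integrand_le {C x δ : ℝ} (hC0 : 0 ≤ C)
    (hC : ∀ p : ℂ, p ≠ 0 → 0 ≤ p.im → ‖p‖ ≤ (|e| + 2 * t + 4) / 2 → ‖φ p‖ ≤ C * (√‖p‖)⁻¹)
    (ht : 0 < t) (hx : x ∈ Ioo (-2) 2) (hne : e + t * x ≠ 0)
    (hδ : δ ∈ Icc 0 ((4 - |e| - 2 * t) / (2 * t))) :
    ‖φ (e + t * (x + (δ : ℝ) * Complex.I)) * invSqrt (4 - (x + (δ : ℝ) * Complex.I) ^ 2)‖ ≤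
      C * ((√|e + t * x|)⁻¹ * (√(4 - x ^ 2))⁻¹) := by
  have hre : ((e : ℂ) + t * (x + (δ : ℝ) * Complex.I)).re = e + t * x := by simp
  have him : ((e : ℂ) + t * (x + (δ : ℝ) * Complex.I)).im = t * δ := by simp
  set p := (e : ℂ) + t * (x + (δ : ℝ) * Complex.I) with hp
  have hp0 : p ≠ 0 := fun h => hne (by rw [← hre, h, Complex.zero_re])
  have hpn : ‖p‖ ≤ (|e| + 2 * t + 4) / 2 := by
    refine (Complex.norm_le_abs_re_add_abs_im p).trans ?_
    rw [hre, him, abs_of_nonneg (mul_nonneg ht.le hδ.1)]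
    have h3 := abs_add_mul_le (e := e) ht (Ioo_subset_Icc_self hx)
    have h4 := (le_div_iff₀ (by linarith)).mp hδ.2
    linarith
  have h5 : |e + t * x| ≤ ‖p‖ := by
    rw [← hre]
    exact Complex.abs_re_le_norm p
  have h6 : 0 < 4 - x ^ 2 := by nlinarith [hx.1, hx.2]
  have h7 := abs_pos.mpr hne
  rw [norm_mul, ← mul_assoc]
  refine mul_le_mul ((hC p hp0 (by rw [him]; exact mul_nonneg ht.le hδ.1) hpn).trans ?_)
    (norm_invSqrt_le h6 (le_norm_four_sub_sq_chord hx.1.le δ)) (norm_nonneg _) (by positivity)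
  have := Real.sqrt_pos.mpr h7
  gcongr

lemma aestronglyMeasurable_chord_integrand (hφ : DifferentiableOn ℂ φ (slitDisc 4)) {w : ℂ}
    (hw : ∀ x ∈ Ioo (-2 : ℝ) 2, e + t * x ≠ 0 → (e : ℂ) + t * (x + w) ∈ slitDisc 4)
    (ht : 0 < t) :
    AEStronglyMeasurable (fun x : ℝ => φ (e + t * (x + w)) * invSqrt (4 - (x + w) ^ 2))
      (volume.restrict (Ioo (-2) 2)) := by
  have hm := measurable_invSqrt
  refine AEStronglyMeasurable.mul ?_ (Measurable.aestronglyMeasurable (by fun_prop))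
  have hS : MeasurableSet (Ioo (-2 : ℝ) 2 ∩ {x | e + t * x ≠ 0}) :=
    measurableSet_Ioo.inter (measurableSet_eq_fun (by fun_prop) (by fun_prop)).compl
  have h1 : ContinuousOn (fun x : ℝ => φ (e + t * (x + w)))
      (Ioo (-2 : ℝ) 2 ∩ {x | e + t * x ≠ 0}) :=
    hφ.continuousOn.comp (by fun_prop) fun x hx => hw x hx.1 hx.2
  have h2 := h1.aestronglyMeasurable (μ := volume) hS
  rwa [Measure.restrict_congr_set (inter_ae_eq_left_of_ae_eq_univ ?_)] at h2
  exact Filter.eventuallyEq_univ.mpr (ae_add_mul_ne_zero ht)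

/-- The integral over the chord `[-2, 2]` equals the one over the semicircle. -/
lemma integral_chord_eq_arcAverage (hφ : DifferentiableOn ℂ φ (slitDisc 4))
    (hC : ∀ ρ < 4, ∃ C, 0 ≤ C ∧ ∀ p : ℂ, p ≠ 0 → 0 ≤ p.im → ‖p‖ ≤ ρ → ‖φ p‖ ≤ C * (√‖p‖)⁻¹)
    (ht : 0 < t) (h1 : |e| < 2 * t) (h2 : |e| + 2 * t < 4) :
    IntegrableOn (fun x : ℝ => φ (e + t * x) * invSqrt (4 - x ^ 2)) (Ioo (-2) 2) ∧
    (∫ x in Ioo (-2 : ℝ) 2, φ (e + t * x) * invSqrt (4 - x ^ 2)) / π = arcAverage φ t e := by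
  obtain ⟨C, hC0, hC⟩ := hC ((|e| + 2 * t + 4) / 2) (by linarith)
  have hδ0 : 0 < (4 - |e| - 2 * t) / (2 * t) := div_pos (by linarith) (by linarith)
  have hbi : IntegrableOn (fun x => C * ((√|e + t * x|)⁻¹ * (√(4 - x ^ 2))⁻¹)) (Ioo (-2) 2) := by
    have := (intervalIntegrable_inv_sqrt_mul ht h1).const_mul C
    rwa [intervalIntegrable_iff_integrableOn_Ioo_of_le (by norm_num)] at this
  have hne : ∀ᵐ x ∂(volume.restrict (Ioo (-2 : ℝ) 2)), x ∈ Ioo (-2 : ℝ) 2 ∧ e + t * x ≠ 0 :=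
    (ae_restrict_mem measurableSet_Ioo).and (ae_restrict_of_ae (ae_add_mul_ne_zero ht))
  have hreal {x : ℝ} (hx : x ∈ Ioo (-2 : ℝ) 2) (h0 : e + t * x ≠ 0) :
      (e : ℂ) + t * x ∈ slitDisc 4 := by
    have := ofReal_mem_slitDisc h0
      ((abs_add_mul_le ht (Ioo_subset_Icc_self hx)).trans_lt h2)
    push_cast at this
    exact this
  have hint : IntegrableOn (fun x : ℝ => φ (e + t * x) * invSqrt (4 - x ^ 2)) (Ioo (-2) 2) := by
    have hm := aestronglyMeasurable_chord_integrand hφ (e := e) (t := t) (w := 0)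
      (fun x hx h0 => by rw [add_zero]; exact hreal hx h0) ht
    simp only [add_zero] at hm
    refine Integrable.mono' hbi hm ?_
    filter_upwards [hne] with x hx
    simpa using norm_shifted_chord_integrand_le hC0 hC ht hx.1 hx.2 ⟨le_rfl, hδ0.le⟩
  refine ⟨hint, ?_⟩
  -- The chord passes through the singularity `-e / t` and ends at the branch points `±2`. Both
  -- contours are therefore raised by `δ`, compared by Cauchy's theorem, and lowered again by
  -- dominated convergence.
  have hev : ∀ᶠ δ : ℝ in nhdsWithin 0 (Ioi 0), δ ∈ Ioo 0 ((4 - |e| - 2 * t) / (2 * t)) :=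
    Ioo_mem_nhdsGT hδ0
  have hlim : Filter.Tendsto (fun δ : ℝ => ∫ x in Ioo (-2 : ℝ) 2,
      φ (e + t * (x + (δ : ℝ) * Complex.I)) * invSqrt (4 - (x + (δ : ℝ) * Complex.I) ^ 2))
      (nhdsWithin 0 (Ioi 0))
      (nhds (∫ x in Ioo (-2 : ℝ) 2, φ (e + t * x) * invSqrt (4 - x ^ 2))) := by
    refine tendsto_integral_filter_of_dominated_convergence _ ?_ ?_ hbi ?_
    · filter_upwards [hev] with δ hδ
      refine aestronglyMeasurable_chord_integrand hφ (fun x hx _ => ?_) ht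
      refine mem_slitDisc_of_im_pos (by simpa using mul_pos ht hδ.1) ?_
      refine (Complex.norm_le_abs_re_add_abs_im _).trans_lt ?_
      have hre : ((e : ℂ) + t * (x + (δ : ℝ) * Complex.I)).re = e + t * x := by simp
      have him : ((e : ℂ) + t * (x + (δ : ℝ) * Complex.I)).im = t * δ := by simp
      rw [hre, him, abs_of_pos (mul_pos ht hδ.1)]
      have h3 := abs_add_mul_le (e := e) ht (Ioo_subset_Icc_self hx)
      have h4 := (lt_div_iff₀ (by linarith)).mp hδ.2
      nlinarith [mul_pos ht hδ.1]
    · filter_upwards [hev] with δ hδ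
      filter_upwards [hne] with x hx
      exact norm_shifted_chord_integrand_le hC0 hC ht hx.1 hx.2 (Ioo_subset_Icc_self hδ)
    · filter_upwards [hne] with x hx
      refine tendsto_comp_shift (g := fun u => φ (e + t * u) * invSqrt (4 - u ^ 2)) ?_
      have h4 : DifferentiableAt ℂ (fun u : ℂ => φ (e + t * u)) x :=
        DifferentiableAt.comp (x : ℂ)
          (hφ.differentiableAt ((isOpen_slitDisc 4).mem_nhds (hreal hx.1 hx.2))) (by fun_prop)
      have h5 : DifferentiableAt ℂ (fun u : ℂ => invSqrt (4 - u ^ 2)) x := by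
        refine DifferentiableAt.invSqrt (by fun_prop) (mem_slitPlane_of_re_pos ?_)
        rw [← Complex.ofReal_pow]
        simp only [Complex.sub_re, Complex.re_ofNat, Complex.ofReal_re]
        nlinarith [hx.1.1, hx.1.2]
      exact (h4.fun_mul h5).continuousAt
  have harc := tendsto_integral_shifted_arc hφ ht h1 h2
  rw [arcAverage_eq]
  congr 1
  refine tendsto_nhds_unique hlim (harc.congr' ?_)
  have hev2 : ∀ᶠ δ : ℝ in nhdsWithin 0 (Ioi 0), δ ∈ Ioo 0 ((4 - |e| - 2 * t) / t) :=
    Ioo_mem_nhdsGT (div_pos (by linarith) ht)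
  filter_upwards [hev2] with δ hδ
  -- The raised contours lie in this convex set, on which the integrand is holomorphic and so has a
  -- primitive.
  have hU : Convex ℝ {u : ℂ | 0 < u.im ∧ ‖(e : ℂ) + t * u‖ < 4} := by
    intro u hu v hv a b ha hb hab
    refine ⟨convex_halfSpace_im_gt 0 hu.1 hv.1 ha hb hab, ?_⟩
    have h3 := convex_ball (0 : ℂ) 4 (mem_ball_zero_iff.mpr hu.2) (mem_ball_zero_iff.mpr hv.2)
      ha hb hab
    rw [mem_ball_zero_iff] at h3
    have hab' : (a : ℂ) + b = 1 := by exact_mod_cast hab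
    have h4 : (e : ℂ) + t * (a • u + b • v) = a • ((e : ℂ) + t * u) + b • ((e : ℂ) + t * v) := by
      simp only [Complex.real_smul]
      linear_combination (-(e : ℂ)) * hab'
    rwa [← h4] at h3
  have hUo : IsOpen {u : ℂ | 0 < u.im ∧ ‖(e : ℂ) + t * u‖ < 4} :=
    (isOpen_lt continuous_const Complex.continuous_im).inter
      (isOpen_lt (f := fun u : ℂ => ‖(e : ℂ) + t * u‖) (by fun_prop) continuous_const)
  have key := integral_arc_eq_integral_chord hU hUo
    (g := fun u => φ (e + t * u) * invSqrt (4 - u ^ 2)) (w := (δ : ℝ) * Complex.I) ?_ ?_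
  · rw [key, intervalIntegral.integral_of_le (by norm_num), integral_Ioc_eq_integral_Ioo]
  · intro u hu
    have h3 : (e : ℂ) + t * u ∈ slitDisc 4 := mem_slitDisc_of_im_pos
      (by simpa using mul_pos ht hu.1) hu.2
    have h4 : DifferentiableAt ℂ (fun u : ℂ => φ (e + t * u)) u :=
      DifferentiableAt.comp u (hφ.differentiableAt ((isOpen_slitDisc 4).mem_nhds h3)) (by fun_prop)
    exact (h4.fun_mul (DifferentiableAt.invSqrt (by fun_prop)
      (four_sub_sq_mem_slitPlane hu.1))).differentiableWithinAt
  · intro θ hθ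
    have hs := Real.sin_nonneg_of_mem_Icc hθ
    refine ⟨?_, ?_⟩
    · have h3 : (circleMap 0 2 θ + (δ : ℝ) * Complex.I).im = 2 * Real.sin θ + δ := by
        rw [Complex.add_im, circleMap_two_im]
        simp
      rw [h3]
      linarith [hδ.1]
    · have h4 := (lt_div_iff₀ ht).mp hδ.2
      calc ‖(e : ℂ) + t * (circleMap 0 2 θ + (δ : ℝ) * Complex.I)‖
          ≤ |e| + t * (2 + δ) := by
            refine (norm_add_le _ _).trans ?_
            rw [Complex.norm_real, Real.norm_eq_abs, norm_mul, Complex.norm_real,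
              Real.norm_of_nonneg ht.le]
            gcongr
            refine (norm_add_le _ _).trans (le_of_eq ?_)
            rw [norm_mul, Complex.norm_I, mul_one, Complex.norm_real,
              Real.norm_of_nonneg hδ.1.le, norm_circleMap_zero,
              abs_of_pos (by norm_num : (0 : ℝ) < 2)]
        _ < 4 := by linarith

end Deformation

/-! ### The three-dimensional density as a contour integral -/

section Average

variable {t e : ℝ}

/-- The arcsine average of the two-dimensional density of states as a contour integral. -/
lemma integral_dos2D_eq_arcAverage_re (ht : 0 < t) (h1 : |e| < 2 * t) (h2 : |e| + 2 * t < 4) :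
    IntegrableOn (fun u : ℝ => dos2D (e + t * u) * (√(4 - u ^ 2))⁻¹) (Ioo (-2) 2) ∧
    (∫ u in Ioo (-2 : ℝ) 2, dos2D (e + t * u) * (√(4 - u ^ 2))⁻¹) / π =
      (arcAverage dosBranch t e).re := by
  obtain ⟨hint, heq⟩ := integral_chord_eq_arcAverage differentiableOn_dosBranch
    (fun ρ hρ => norm_dosBranch_le hρ) ht h1 h2
  have hae : ∀ᵐ u : ℝ ∂(volume.restrict (Ioo (-2 : ℝ) 2)),
      (dosBranch (e + t * u) * invSqrt (4 - u ^ 2)).re = dos2D (e + t * u) * (√(4 - u ^ 2))⁻¹ := by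
    filter_upwards [ae_restrict_mem measurableSet_Ioo, ae_restrict_of_ae (ae_add_mul_ne_zero ht)]
      with u hu h0
    have h3 : (4 : ℂ) - u ^ 2 = ((4 - u ^ 2 : ℝ) : ℂ) := by push_cast; rfl
    have h4 : (e : ℂ) + t * u = ((e + t * u : ℝ) : ℂ) := by push_cast; rfl
    rw [h3, invSqrt_ofReal (by nlinarith [hu.1, hu.2]), Complex.re_mul_ofReal, h4,
      dos2D_eq_dosBranch_re h0 ((abs_add_mul_le ht (Ioo_subset_Icc_self hu)).trans_lt h2)]
  refine ⟨hint.re.congr hae, ?_⟩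
  rw [← heq, Complex.div_ofReal_re, ← integral_congr_ae hae]
  congr 1
  exact integral_re hint

lemma dos2D_nonneg (x : ℝ) : 0 ≤ dos2D x := monotone_stepAverage_hopping2D.deriv_nonneg

/-- Monotonicity of the integrated density makes this hold across all singularities, including those
at `0` and `±4`. -/
lemma intervalIntegrable_dos2D (a b : ℝ) : IntervalIntegrable dos2D volume a b :=
  (monotone_stepAverage_hopping2D.monotoneOn _).intervalIntegrable_deriv

lemma integral_dos2D {a b : ℝ} (ha : |a| < 4) (hb : |b| < 4) :
    ∫ x in a..b, dos2D x = stepAverage hopping2D b - stepAverage hopping2D a := by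
  refine integral_eq_of_hasDerivAt_off_countable (stepAverage hopping2D) dos2D
    (countable_singleton 0) continuous_stepAverage_hopping2D.continuousOn ?_
    (intervalIntegrable_dos2D a b)
  rintro x ⟨hx, hx0⟩
  refine (hasDerivAt_stepAverage_hopping2D (by simpa using hx0) ?_).differentiableAt.hasDerivAt
  rw [abs_lt] at ha hb ⊢
  exact ⟨(lt_min ha.1 hb.1).trans hx.1, hx.2.trans (max_lt ha.2 hb.2)⟩

/-- The averaging formula in integrated form. The size conditions keep the shifted energies in `(-4,
4)`, where `integral_dos2D` applies. -/
lemma stepAverage_hopping3D_sub (ht : 0 < t) {a b : ℝ} (hab : a ≤ b) (ha : |a| + 2 * t < 4)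
    (hb : |b| + 2 * t < 4) :
    stepAverage (hopping3D t) b - stepAverage (hopping3D t) a = ∫ x in a..b,
      (∫ u in Ioo (-2 : ℝ) 2, dos2D (x + t * u) * (√(4 - u ^ 2))⁻¹) / π := by
  have hpi : -π ≤ π := by linarith [Real.pi_pos]
  have hi (c : ℝ) : Integrable (fun k => stepAverage hopping2D (c + 2 * t * Real.cos k))
      (volume.restrict (Ioc (-π) π)) :=
    Continuous.integrableOn_Ioc (continuous_stepAverage_hopping2D.comp (by fun_prop))
  have hs {c : ℝ} (hc : |c| + 2 * t < 4) (k : ℝ) : |c + 2 * t * Real.cos k| < 4 := by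
    refine (abs_add_le _ _).trans_lt (lt_of_le_of_lt ?_ hc)
    rw [abs_mul, abs_of_pos (by positivity : 0 < 2 * t)]
    nlinarith [Real.abs_cos_le_one k]
  have h1 (x : ℝ) : ∫ k in -π..π, dos2D (x + 2 * t * Real.cos k) =
      2 * ∫ u in Ioo (-2 : ℝ) 2, dos2D (x + t * u) * (√(4 - u ^ 2))⁻¹ := by
    rw [← integral_comp_two_mul_cos fun u => dos2D (x + t * u)]
    refine intervalIntegral.integral_congr fun k _ => ?_
    exact congrArg dos2D (by ring)
  have h2 : ∀ x, (∫ u in Ioo (-2 : ℝ) 2, dos2D (x + t * u) * (√(4 - u ^ 2))⁻¹) / π =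
      (∫ k in -π..π, dos2D (x + 2 * t * Real.cos k)) / (2 * π) := by
    intro x
    rw [h1]
    field_simp
  simp only [h2]
  rw [intervalIntegral.integral_div, stepAverage_hopping3D, stepAverage_hopping3D, ← sub_div]
  simp only [intervalIntegral.integral_of_le hpi]
  rw [integral_translate_sub (μ := volume.restrict (Ioc (-π) π)) (f' := dos2D)
    (f := stepAverage hopping2D) (s := fun k => 2 * t * Real.cos k) (by fun_prop)
    (measurable_deriv _) dos2D_nonneg hab (fun k => intervalIntegrable_dos2D _ _)
    (fun k => integral_dos2D (hs ha k) (hs hb k)) (hi a) (hi b)]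

/-- Holomorphy of `arcAverage` makes the integrated formula's density continuous, so it is the
derivative at every point. -/
lemma hasDerivAt_stepAverage_hopping3D (ht : 0 < t) (h : |e| < min (2 * t) (4 - 2 * t)) :
    HasDerivAt (stepAverage (hopping3D t)) (arcAverage dosBranch t e).re e := by
  refine hasDerivAt_of_sub_eq_integral (g := fun e : ℝ => (arcAverage dosBranch t e).re)
    (l := -min (2 * t) (4 - 2 * t)) (u := min (2 * t) (4 - 2 * t)) ?_ ?_ (abs_lt.mp h)
  · intro x hx
    rw [mem_Ioo, ← abs_lt, lt_min_iff] at hx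
    have h1 := (hasDerivAt_arcAverage differentiableOn_dosBranch ht (e := (x : ℂ))
      (by rw [Complex.norm_real, Real.norm_eq_abs]; exact hx.1)
      (by rw [Complex.norm_real, Real.norm_eq_abs]; linarith [hx.2])).2
    exact h1.real_of_complex.continuousAt.continuousWithinAt
  · intro a b ha hab hb
    have hx : ∀ x ∈ Icc a b, |x| < 2 * t ∧ |x| + 2 * t < 4 := by
      intro x hx
      have : |x| < min (2 * t) (4 - 2 * t) := abs_lt.mpr ⟨ha.trans_le hx.1, hx.2.trans_lt hb⟩
      rw [lt_min_iff] at this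
      exact ⟨this.1, by linarith [this.2]⟩
    rw [stepAverage_hopping3D_sub ht hab (hx a (left_mem_Icc.mpr hab)).2
      (hx b (right_mem_Icc.mpr hab)).2]
    refine intervalIntegral.integral_congr fun x hx' => ?_
    rw [uIcc_of_le hab] at hx'
    exact (integral_dos2D_eq_arcAverage_re ht (hx x hx').1 (hx x hx').2).2

lemma dos3D_eq_arcAverage_re (ht : 0 < t) (h : |e| < min (2 * t) (4 - 2 * t)) :
    dos3D t e = (arcAverage dosBranch t e).re :=
  (hasDerivAt_stepAverage_hopping3D ht h).deriv

end Average

/-! ### Taylor expansion and the derivatives at zero -/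

lemma DifferentiableOn.iteratedDeriv_of_isOpen {f : ℂ → ℂ} {s : Set ℂ} (hf : DifferentiableOn ℂ f s)
    (hs : IsOpen s) (n : ℕ) : DifferentiableOn ℂ (iteratedDeriv n f) s := by
  induction n with
  | zero => simpa using hf
  | succ n ih =>
    rw [iteratedDeriv_succ]
    exact ih.deriv hs

section Taylor

variable {φ : ℂ → ℂ} {t : ℝ}

lemma hasDerivAt_arcAverage_iteratedDeriv (hφ : DifferentiableOn ℂ φ (slitDisc 4)) (ht : 0 < t)
    (n : ℕ) {e : ℂ} (he : ‖e‖ < min (2 * t) (4 - 2 * t)) :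
    HasDerivAt (arcAverage (iteratedDeriv n φ) t) (arcAverage (iteratedDeriv (n + 1) φ) t e) e := by
  rw [lt_min_iff] at he
  rw [iteratedDeriv_succ]
  exact (hasDerivAt_arcAverage (hφ.iteratedDeriv_of_isOpen (isOpen_slitDisc 4) n) ht he.1
    (by linarith [he.2])).2

lemma iteratedDeriv_arcAverage (hφ : DifferentiableOn ℂ φ (slitDisc 4)) (ht : 0 < t)
    (n : ℕ) {e : ℂ} (he : ‖e‖ < min (2 * t) (4 - 2 * t)) :
    iteratedDeriv n (arcAverage φ t) e = arcAverage (iteratedDeriv n φ) t e := by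
  induction n generalizing e with
  | zero => simp
  | succ n ih =>
    rw [iteratedDeriv_succ]
    refine ((hasDerivAt_arcAverage_iteratedDeriv hφ ht n he).congr_of_eventuallyEq ?_).deriv
    filter_upwards [(isOpen_lt continuous_norm continuous_const).mem_nhds he] with z hz
    exact ih hz

lemma iteratedDeriv_dos3D (ht : 0 < t) (n : ℕ) {e : ℝ} (he : |e| < min (2 * t) (4 - 2 * t)) :
    iteratedDeriv n (dos3D t) e = (arcAverage (iteratedDeriv n dosBranch) t e).re := by
  induction n generalizing e with
  | zero => simpa using dos3D_eq_arcAverage_re ht he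
  | succ n ih =>
    rw [iteratedDeriv_succ]
    refine ((hasDerivAt_arcAverage_iteratedDeriv differentiableOn_dosBranch ht n
      (by rwa [Complex.norm_real, Real.norm_eq_abs])).real_of_complex.congr_of_eventuallyEq ?_).deriv
    filter_upwards [(isOpen_lt continuous_abs continuous_const).mem_nhds he] with z hz
    exact ih hz

/-- Odd derivatives of an even function vanish at the origin. -/
lemma iteratedDeriv_odd_dos3D (j : ℕ) : iteratedDeriv (2 * j + 1) (dos3D t) 0 = 0 := by
  have h := iteratedDeriv_comp_neg (2 * j + 1) (dos3D t) 0
  simp only [dos3D_neg, neg_zero, Odd.neg_one_pow (odd_two_mul_add_one j), neg_smul, one_smul] at h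
  linarith

/-- `arcAverage dosBranch t` is holomorphic on the full complex disc of radius `r`, so its Taylor
series converges on all of it; real parts are then taken. -/
lemma hasSum_dos3D (ht : 0 < t) {e : ℝ} (he : |e| < min (2 * t) (4 - 2 * t)) :
    HasSum (fun j : ℕ => iteratedDeriv (2 * j) (dos3D t) 0 / ((2 * j).factorial : ℝ) * e ^ (2 * j))
      (dos3D t e) := by
  set r := min (2 * t) (4 - 2 * t) with hr
  have hr0 : 0 < r := (abs_nonneg e).trans_lt he
  have hd : DifferentiableOn ℂ (arcAverage dosBranch t) (Metric.ball 0 r) := by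
    intro z hz
    have := hasDerivAt_arcAverage_iteratedDeriv differentiableOn_dosBranch ht 0
      (mem_ball_zero_iff.mp hz)
    rw [iteratedDeriv_zero] at this
    exact this.differentiableAt.differentiableWithinAt
  have h1 := Complex.hasSum_re (Complex.hasSum_taylorSeries_on_ball hd (z := (e : ℂ))
    (by rwa [mem_ball_zero_iff, Complex.norm_real, Real.norm_eq_abs]))
  rw [← dos3D_eq_arcAverage_re ht he] at h1
  have h2 (n : ℕ) : (((n.factorial : ℂ)⁻¹ • ((e : ℂ) - 0) ^ n •
      iteratedDeriv n (arcAverage dosBranch t) 0).re) =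
      iteratedDeriv n (dos3D t) 0 / (n.factorial : ℝ) * e ^ n := by
    rw [iteratedDeriv_dos3D ht n (by rwa [abs_zero]),
      iteratedDeriv_arcAverage differentiableOn_dosBranch ht n (by rwa [norm_zero]), sub_zero,
      smul_eq_mul, smul_eq_mul, ← Complex.ofReal_natCast, ← Complex.ofReal_inv,
      ← Complex.ofReal_pow, Complex.re_ofReal_mul, Complex.re_ofReal_mul, Complex.ofReal_zero]
    ring
  simp only [h2] at h1
  -- Dropping the vanishing odd terms leaves a sum indexed by `j ↦ 2 * j`.
  have hinj : Function.Injective fun j : ℕ => 2 * j := fun a b h => by simpa using h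
  refine (hinj.hasSum_iff ?_).mpr h1
  intro n hn
  rcases Nat.even_or_odd' n with ⟨k, rfl | rfl⟩
  · exact absurd ⟨k, rfl⟩ hn
  · rw [iteratedDeriv_odd_dos3D, zero_div, zero_mul]

lemma analyticOnNhd_dos3D (ht : 0 < t) :
    AnalyticOnNhd ℝ (dos3D t) {e : ℝ | |e| < min (2 * t) (4 - 2 * t)} := by
  intro e he
  have hopen : IsOpen {z : ℂ | ‖z‖ < min (2 * t) (4 - 2 * t)} :=
    isOpen_lt continuous_norm continuous_const
  have hd : DifferentiableOn ℂ (arcAverage dosBranch t) {z : ℂ | ‖z‖ < min (2 * t) (4 - 2 * t)} := by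
    intro z hz
    have := hasDerivAt_arcAverage_iteratedDeriv differentiableOn_dosBranch ht 0 hz
    rw [iteratedDeriv_zero] at this
    exact this.differentiableAt.differentiableWithinAt
  have he' : (e : ℂ) ∈ {z : ℂ | ‖z‖ < min (2 * t) (4 - 2 * t)} := by
    simpa only [mem_ofPred_eq, Complex.norm_real, Real.norm_eq_abs] using he
  refine (hd.analyticOnNhd hopen _ he').re_ofReal.congr ?_
  filter_upwards [(isOpen_lt continuous_abs continuous_const).mem_nhds he] with z hz
  exact (dos3D_eq_arcAverage_re ht hz).symm

/-- On the open arc `t * u` lies in the upper half of the disc of radius `4`, an open set where `F =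
dosBranch`, so all derivatives agree. The endpoints are excluded and carry no mass. -/
lemma IsUpperContinuation.semicircleIntegrand_eq {F : ℂ → ℂ} (hF : IsUpperContinuation F)
    (ht : 0 < t) (ht2 : t < 2) (n : ℕ) {θ : ℝ} (hθ : θ ∈ Ioo 0 π) :
    semicircleIntegrand (contourKernel F t n) θ =
      iteratedDeriv n dosBranch ((0 : ℂ) + t * circleMap 0 2 θ) * arcWeight θ := by
  have h1 : semicircleIntegrand (contourKernel F t n) θ =
      iteratedDeriv n F (t * circleMap 0 2 θ) * arcWeight θ :=
    _root_.semicircleIntegrand_eq (fun u => iteratedDeriv n F (t * u)) θ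
  rw [h1, zero_add]
  congr 1
  refine Filter.EventuallyEq.iteratedDeriv_eq n ?_
  have hopen : IsOpen {z : ℂ | 0 < z.im ∧ ‖z‖ < 4} :=
    (isOpen_lt continuous_const Complex.continuous_im).inter
      (isOpen_lt continuous_norm continuous_const)
  refine Filter.eventuallyEq_of_mem (hopen.mem_nhds ⟨?_, ?_⟩) hF.eqOn_dosBranch
  · rw [Complex.im_ofReal_mul, circleMap_two_im]
    have := Real.sin_pos_of_mem_Ioo hθ
    positivity
  · rw [norm_mul, Complex.norm_real, Real.norm_of_nonneg ht.le, norm_circleMap_zero,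
      abs_of_pos (by norm_num : (0 : ℝ) < 2)]
    linarith

lemma IsUpperContinuation.intervalIntegrable_semicircleIntegrand {F : ℂ → ℂ}
    (hF : IsUpperContinuation F) (ht : 0 < t) (ht2 : t < 2) (n : ℕ) :
    IntervalIntegrable (semicircleIntegrand (contourKernel F t n)) volume π 0 := by
  refine IntervalIntegrable.symm ?_
  rw [intervalIntegrable_iff_integrableOn_Ioo_of_le Real.pi_pos.le]
  have h := (hasDerivAt_arcAverage (differentiableOn_dosBranch.iteratedDeriv_of_isOpen
    (isOpen_slitDisc 4) n) ht (e := 0) (by rw [norm_zero]; linarith)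
    (by rw [norm_zero]; linarith)).1
  exact h.congr_fun (fun θ hθ => (hF.semicircleIntegrand_eq ht ht2 n hθ).symm) measurableSet_Ioo

lemma IsUpperContinuation.semicircleIntegral_contourKernel {F : ℂ → ℂ}
    (hF : IsUpperContinuation F) (ht : 0 < t) (ht2 : t < 2) (n : ℕ) :
    semicircleIntegral (contourKernel F t n) = arcAverage (iteratedDeriv n dosBranch) t 0 := by
  rw [arcAverage, semicircleIntegral_eq fun u => iteratedDeriv n dosBranch (0 + t * u),
    semicircleIntegral, integral_pi_zero_eq]
  congr 1
  exact setIntegral_congr_fun measurableSet_Ioo fun θ hθ => hF.semicircleIntegrand_eq ht ht2 n hθ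

end Taylor

end

theorem theorem2p1 (tz : ℝ) (htz0 : 0 < tz) (htz2 : tz < 2) :
    -- the delta integrals defining the densities of states make sense
    (∀ ε : ℝ, ε ≠ 0 → |ε| < 4 → DifferentiableAt ℝ (stepAverage hopping2D) ε) ∧
    (∀ ε : ℝ, |ε| < min (2 * tz) (4 - 2 * tz) →
      DifferentiableAt ℝ (stepAverage (hopping3D tz)) ε) ∧
    -- the three-dimensional density of states is even and real analytic
    (∀ ε : ℝ, dos3D tz (-ε) = dos3D tz ε) ∧
    AnalyticOnNhd ℝ (dos3D tz) {ε : ℝ | |ε| < min (2 * tz) (4 - 2 * tz)} ∧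
    (∀ ε : ℝ, |ε| < min (2 * tz) (4 - 2 * tz) →
      HasSum (fun j : ℕ =>
        iteratedDeriv (2 * j) (dos3D tz) 0 / ((2 * j).factorial : ℝ) * ε ^ (2 * j))
        (dos3D tz ε)) ∧
    -- the value at zero
    IntervalIntegrable (fun u : ℝ => dos2D (tz * u) / √(4 - u ^ 2) / π)
      MeasureTheory.volume (-2) 2 ∧
    dos3D tz 0 = ∫ u in (-2 : ℝ)..2, dos2D (tz * u) / √(4 - u ^ 2) / π ∧
    -- the analytic continuation exists and is unique
    (∃ F : ℂ → ℂ, IsUpperContinuation F) ∧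
    (∀ F G : ℂ → ℂ, IsUpperContinuation F → IsUpperContinuation G →
      ∀ z : ℂ, 0 < z.im → F z = G z) ∧
    -- the higher even derivatives at zero
    (∀ F : ℂ → ℂ, IsUpperContinuation F → ∀ j : ℕ, 1 ≤ j →
      IntervalIntegrable (semicircleIntegrand (contourKernel F tz (2 * j)))
        MeasureTheory.volume π 0 ∧
      iteratedDeriv (2 * j) (dos3D tz) 0 =
        (semicircleIntegral (contourKernel F tz (2 * j))).re) := by
  have hr : 0 < min (2 * tz) (4 - 2 * tz) := lt_min (by linarith) (by linarith)
  have h0 := integral_dos2D_eq_arcAverage_re htz0 (e := 0) (by rw [abs_zero]; linarith)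
    (by rw [abs_zero]; linarith)
  simp only [zero_add] at h0
  refine ⟨fun ε h h4 => (hasDerivAt_stepAverage_hopping2D h h4).differentiableAt,
    fun ε h => (hasDerivAt_stepAverage_hopping3D htz0 h).differentiableAt, dos3D_neg tz,
    analyticOnNhd_dos3D htz0, fun ε h => hasSum_dos3D htz0 h, ?_, ?_,
    ⟨_, isUpperContinuation_slitK⟩, fun F G hF hG z hz => hF.eq hG hz,
    fun F hF j _ => ⟨hF.intervalIntegrable_semicircleIntegrand htz0 htz2 _, ?_⟩⟩
  · rw [intervalIntegrable_iff_integrableOn_Ioo_of_le (by norm_num)]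
    exact h0.1.div_const π
  · rw [dos3D_eq_arcAverage_re htz0 (by rwa [abs_zero]), ← h0.2,
      intervalIntegral.integral_of_le (by norm_num), MeasureTheory.integral_Ioc_eq_integral_Ioo,
      ← MeasureTheory.integral_div]
    simp only [div_eq_mul_inv]
  · rw [hF.semicircleIntegral_contourKernel htz0 htz2,
      iteratedDeriv_dos3D htz0 _ (by rwa [abs_zero]), Complex.ofReal_zero]
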